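/- Let $0<\Delta<\sigma_1^2\le\sigma_2^2\le\dots\le\sigma_r^2<\sigma_x^2$ and $0<\sigma_z^2<\sigma_x^2$. Put $\Delta_j=\frac{\sigma_j^2\Delta}{\sigma_j^2-\Delta}$ and $\alpha_j=\frac{\sigma_x^2}{\sigma_x^2+\Delta_j}$ for $1\le j\le r$. Let $X'_0,\dots,X'_r,Z'$ be independent centred Gaussian random variables (possibly degenerate) with $$\operatorname{Var}X'_0=\alpha_1\sigma_x^2,\quad \operatorname{Var}X'_j=\alpha_j\Delta_j-\alpha_{j+1}\Delta_{j+1}\ (1\le j<r),\quad \operatorname{Var}X'_r=\alpha_r\Delta_r,\quad \operatorname{Var}Z'=\frac{\sigma_x^2\sigma_z^2}{\sigma_x^2-\sigma_z^2}.$$ Set $A_k=\sum_{t=0}^{k-1}X'_t$ for $0\le k\le r$ (so $A_0=0$), $X=\sum_{t=0}^{r}X'_t$, $\bar Y=X+Z'$, $Y=\frac{\sigma_x^2-\sigma_z^2}{\sigma_x^2}\bar Y$, and, for $1\le j\le r$, $X_j=X-A_{j-1}$ and $Y_j=\bar Y-A_{j-1}$. Write $I(U\wedge V\mid W)$ for conditional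 mutual information. Then, for every $1\le k\le r$: (a) $(X,Y)$ is the Gaussian source with parameters $\sigma_x^2,\sigma_z^2$, that is, $Y\sim\mathcal N(0,\sigma_x^2-\sigma_z^2)$ and $X-Y\sim\mathcal N(0,\sigma_z^2)$ are independent; moreover $A_k\sim\mathcal N(0,\alpha_k\sigma_x^2)$. (b) $$I(A_k\wedge X\mid\bar Y)=\sum_{j=0}^{k-1}I\left(X'_j\wedge X_{j+1}\mid Y_{j+1}\right).$$ (c) Suppose $\sigma_z^2=\sigma_k^2$. Then $A_k$ is an optimal auxiliary: it is independent of $Y$ given $X$, some measurable function of $(A_k,Y)$ estimates $X$ with mean squared error at most $\Delta$, and $I(A_k\wedge X\mid Y)$ is minimal among all random variables $U$ with values in a standard Borel space, jointly distributed with a copy of $(X,Y)$, that have these two properties. Moreover, the optimal estimate of $X$ by observing $Y$ and $A_k$, i.e. the almost surely unique measurable function of $(Y,A_k)$ minimizing the mean squared error, is $$\hat X_k=A_k+\frac{(\sigma_x^2-\sigma_k^2)\Delta}{\sigma_x^2\sigma_k^2}\left(\frac{\sigma_x^2}{\sigma_x^2-\sigma_k^2}\,Y-A_k\right).$$ -/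

import Mathlib

open MeasureTheory ProbabilityTheory
open scoped ENNReal

namespace WynerZiv

noncomputable section

/-! ### Information-theoretic notions -/

/-- The conditional mutual information `I(U ∧ V | W)` in nats: the relative entropy of the joint law
`P_{WUV}` with respect to `P_W ⊗ (P_{U|W} × P_{V|W})`. -/
def condMutualInfo {Ω α β γ : Type*} [MeasurableSpace Ω]
    [MeasurableSpace α] [StandardBorelSpace α] [Nonempty α]
    [MeasurableSpace β] [StandardBorelSpace β] [Nonempty β] [MeasurableSpace γ]
    (P : Measure Ω) [IsFiniteMeasure P] (U : Ω → α) (V : Ω → β) (W : Ω → γ) : ℝ≥0∞ :=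
  InformationTheory.klDiv (P.map (fun ω => (W ω, U ω, V ω)))
    (P.map W ⊗ₘ (condDistrib U W P ×ₖ condDistrib V W P))

/-- `U` and `V` are conditionally independent given `W` (the Markov relation `U - W - V`), stated
through regular conditional laws: `P_{WUV} = P_W ⊗ (P_{U|W} × P_{V|W})`. -/
def CondIndepGiven {Ω α β γ : Type*} [MeasurableSpace Ω]
    [MeasurableSpace α] [StandardBorelSpace α] [Nonempty α]
    [MeasurableSpace β] [StandardBorelSpace β] [Nonempty β] [MeasurableSpace γ]
    (P : Measure Ω) [IsFiniteMeasure P] (U : Ω → α) (V : Ω → β) (W : Ω → γ) : Prop :=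
  P.map (fun ω => (W ω, U ω, V ω)) =
    P.map W ⊗ₘ (condDistrib U W P ×ₖ condDistrib V W P)

/-- The mean squared error `E[(X - V)²]`, with values in `[0, ∞]`. -/
def mse {Ω : Type*} [MeasurableSpace Ω] (P : Measure Ω) (X V : Ω → ℝ) : ℝ≥0∞ :=
  ∫⁻ ω, ENNReal.ofReal ((X ω - V ω) ^ 2) ∂P

/-- `V` is an optimal estimate of `X` by observing `O`: it is a measurable function of `O`, and no
measurable function of `O` has a smaller mean squared error. -/
def IsOptimalEstimate {Ω α : Type*} [MeasurableSpace Ω] [MeasurableSpace α]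
    (P : Measure Ω) (X : Ω → ℝ) (O : Ω → α) (V : Ω → ℝ) : Prop :=
  (∃ g : α → ℝ, Measurable g ∧ V = fun ω => g (O ω)) ∧
    ∀ g : α → ℝ, Measurable g → mse P X V ≤ mse P X (fun ω => g (O ω))

/-- `U` is an admissible auxiliary for quantizing `X` with side information `Y` at distortion `Δ`:
it is independent of `Y` given `X`, and `X` can be estimated from `(U, Y)` with mean squared error
at most `Δ`. -/
structure IsAuxiliary {Ω α : Type*} [MeasurableSpace Ω]
    [MeasurableSpace α] [StandardBorelSpace α] [Nonempty α]
    (P : Measure Ω) [IsFiniteMeasure P] (X Y : Ω → ℝ) (Δ : ℝ) (U : Ω → α) : Prop where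
  measurable : Measurable U
  markov : CondIndepGiven P U Y X
  distortion : ∃ g : α × ℝ → ℝ, Measurable g ∧
    mse P X (fun ω => g (U ω, Y ω)) ≤ ENNReal.ofReal Δ

/-- `U` is an optimal auxiliary for `(X, Y)` at distortion `Δ`: it is admissible and minimizes
`I(U ∧ X | Y)` among all admissible auxiliaries, over all probability spaces that carry a copy of
`(X, Y)`. -/
def IsOptimalAuxiliary {Ω : Type*} [MeasurableSpace Ω]
    (P : Measure Ω) [IsFiniteMeasure P] (X Y : Ω → ℝ) (Δ : ℝ) (U : Ω → ℝ) : Prop :=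
  IsAuxiliary P X Y Δ U ∧
    ∀ (Ω' α : Type) [MeasurableSpace Ω'] [MeasurableSpace α] [StandardBorelSpace α] [Nonempty α]
      (Q : Measure Ω') [IsProbabilityMeasure Q] (X' Y' : Ω' → ℝ) (V : Ω' → α),
      Measurable X' → Measurable Y' →
      Q.map (fun ω => (X' ω, Y' ω)) = P.map (fun ω => (X ω, Y ω)) →
      IsAuxiliary Q X' Y' Δ V →
      condMutualInfo P U X Y ≤ condMutualInfo Q V X' Y'

/-! ### The Gaussian source and its decomposition

All parameters `σx2`, `σz2`, `σ2 j` are variances. -/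

/-- `X = Y + Z` with `Y ~ N(0, σx2 - σz2)` and `Z ~ N(0, σz2)` independent. -/
structure IsGaussianSource {Ω : Type*} [MeasurableSpace Ω]
    (P : Measure Ω) (σx2 σz2 : ℝ) (X Y : Ω → ℝ) : Prop where
  law_side : HasLaw Y (gaussianReal 0 (σx2 - σz2).toNNReal) P
  law_noise : HasLaw (fun ω => X ω - Y ω) (gaussianReal 0 σz2.toNNReal) P
  indep : IndepFun Y (fun ω => X ω - Y ω) P

/-- `Δ_j = σ_j² Δ / (σ_j² - Δ)`. -/
def testVar (Δ : ℝ) (σ2 : ℕ → ℝ) (j : ℕ) : ℝ := σ2 j * Δ / (σ2 j - Δ)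

/-- `α_j = σ_x² / (σ_x² + Δ_j)`. -/
def alpha (σx2 Δ : ℝ) (σ2 : ℕ → ℝ) (j : ℕ) : ℝ := σx2 / (σx2 + testVar Δ σ2 j)

/-- The variance of the part `X'_t`, `0 ≤ t ≤ r`. -/
def partVar (r : ℕ) (σx2 Δ : ℝ) (σ2 : ℕ → ℝ) (t : ℕ) : ℝ :=
  if t = 0 then alpha σx2 Δ σ2 1 * σx2
  else if t < r then
    alpha σx2 Δ σ2 t * testVar Δ σ2 t - alpha σx2 Δ σ2 (t + 1) * testVar Δ σ2 (t + 1)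
  else alpha σx2 Δ σ2 r * testVar Δ σ2 r

/-- The parts `X'_0, …, X'_r` and the noise `Z'` are independent centred Gaussians with the
prescribed variances. -/
structure IsGaussianParts {Ω : Type*} [MeasurableSpace Ω]
    (P : Measure Ω) (r : ℕ) (σx2 σz2 Δ : ℝ) (σ2 : ℕ → ℝ) (X' : ℕ → Ω → ℝ) (Z' : Ω → ℝ) : Prop where
  measurable_part : ∀ t ≤ r, Measurable (X' t)
  measurable_noise : Measurable Z'
  law_part : ∀ t ≤ r, HasLaw (X' t) (gaussianReal 0 (partVar r σx2 Δ σ2 t).toNNReal) P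
  law_noise : HasLaw Z' (gaussianReal 0 (σx2 * σz2 / (σx2 - σz2)).toNNReal) P
  indep_parts : iIndepFun (fun t : Fin (r + 1) => X' t) P
  indep_noise : IndepFun (fun ω (t : Fin (r + 1)) => X' t ω) Z' P

/-- `A_k = X'_0 + ⋯ + X'_{k-1}`; in particular `A_0 = 0`. -/
def auxA {Ω : Type*} (X' : ℕ → Ω → ℝ) (k : ℕ) (ω : Ω) : ℝ := ∑ t ∈ Finset.range k, X' t ω

/-- The source `X = X'_0 + ⋯ + X'_r`. -/
def srcX {Ω : Type*} (r : ℕ) (X' : ℕ → Ω → ℝ) (ω : Ω) : ℝ := auxA X' (r + 1) ω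

/-- The rescaled side information `Ȳ = X + Z'`. -/
def sideYbar {Ω : Type*} (r : ℕ) (X' : ℕ → Ω → ℝ) (Z' : Ω → ℝ) (ω : Ω) : ℝ :=
  srcX r X' ω + Z' ω

/-- The side information `Y`, related to `Ȳ` by `Ȳ = σ_x² / (σ_x² - σ_z²) Y`. -/
def sideY {Ω : Type*} (r : ℕ) (σx2 σz2 : ℝ) (X' : ℕ → Ω → ℝ) (Z' : Ω → ℝ) (ω : Ω) : ℝ :=
  (σx2 - σz2) / σx2 * sideYbar r X' Z' ω

/-- The source `X_k = X - A_{k-1}` of round `k ≥ 1`. -/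
def roundX {Ω : Type*} (r : ℕ) (X' : ℕ → Ω → ℝ) (k : ℕ) (ω : Ω) : ℝ :=
  srcX r X' ω - auxA X' (k - 1) ω

/-- The side information `Y_k = Ȳ - A_{k-1}` of round `k ≥ 1`. -/
def roundY {Ω : Type*} (r : ℕ) (X' : ℕ → Ω → ℝ) (Z' : Ω → ℝ) (k : ℕ) (ω : Ω) : ℝ :=
  sideYbar r X' Z' ω - auxA X' (k - 1) ω

/-- `X̂_k = A_k + ((σ_x² - σ_k²) Δ / (σ_x² σ_k²)) (σ_x² / (σ_x² - σ_k²) Y - A_k)`, where `s` stands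
for `σ_k²`. -/
def estimateX {Ω : Type*} (σx2 s Δ : ℝ) (Y A : Ω → ℝ) (ω : Ω) : ℝ :=
  A ω + (σx2 - s) * Δ / (σx2 * s) * (σx2 / (σx2 - s) * Y ω - A ω)

end

end WynerZiv

open WynerZiv

/-! For independent Gaussians there is a single rate computation behind everything. If B, C, Z are
independent and centred and C, Z are nondegenerate, observing B in addition to B + C + Z lowers the
conditional variance of X = B + C from `errVar z (b + c)` to `errVar z c`, and `I(B ∧ X | X + Z)` is
half the logarithm of their ratio (`condMutualInfo_gaussian`).

Let T_j be the variance of X'_j + ⋯ + X'_r, so that T_0 = σ_x² and T_j = α_jΔ_j for j ≥ 1, and let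
D_j be the conditional variance of X given Ȳ and A_j. Round j has rate log(D_j / D_{j+1}) / 2 and
A_k has rate log(D_0 / D_k) / 2, so (b) is a telescoping sum.

For (c), precisions add: 1/T_k = 1/Δ - 1/σ_k² + 1/σ_x², and the noise Z' has precision 1/σ_z² -
1/σ_x². If σ_z² = σ_k², the sum is 1/Δ, so D_k = Δ, while D_0 = σ_k². Thus A_k has distortion Δ and
rate log(σ_k² / Δ) / 2.

No auxiliary does better (`le_condMutualInfo`): in the variational bound for relative entropy, take
as test function the log-likelihood ratio of N(g(W, U), d) against N(m(W), v). Its expectation is at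
least log(v / d) / 2 as soon as g has mean squared error at most d. Equality holds when the error is
N(0, d) and independent of (W, U), for then the joint law is exactly the tilted one
(`condMutualInfo_eq_log`). The same independence makes the linear estimate optimal and unique, by
Pythagoras. -/

namespace WynerZiv

open scoped NNReal
open InformationTheory

/-! ### Conditional mutual information through an explicit conditional law -/

section Kernels

variable {Ω α β γ : Type*} [MeasurableSpace Ω] [MeasurableSpace α] [MeasurableSpace β]
  [MeasurableSpace γ]

/-- Relative entropy is invariant under measurable equivalences. -/
lemma klDiv_map_equiv (e : α ≃ᵐ β) (μ ν : Measure α) [IsFiniteMeasure μ] [IsFiniteMeasure ν] :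
    klDiv (μ.map e) (ν.map e) = klDiv μ ν := by
  refine le_antisymm (klDiv_map_le _ _ e.measurable) ?_
  have h := klDiv_map_le (μ.map e) (ν.map e) e.symm.measurable
  simpa [Measure.map_map e.symm.measurable e.measurable] using h

/-- Integrating out the first of two conditionally independent coordinates first. -/
lemma compProd_prod_eq_map (μ : Measure γ) [SFinite μ] (κ : Kernel γ α) [IsSFiniteKernel κ]
    (η : Kernel γ β) [IsSFiniteKernel η] :
    μ ⊗ₘ (κ ×ₖ η) =
      ((μ ⊗ₘ κ) ⊗ₘ (η.prodMkRight α)).map MeasurableEquiv.prodAssoc := by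
  ext s hs
  rw [Measure.map_apply MeasurableEquiv.prodAssoc.measurable hs,
    Measure.compProd_apply hs, Measure.compProd_apply (MeasurableEquiv.prodAssoc.measurable hs),
    Measure.lintegral_compProd (Kernel.measurable_kernel_prodMk_left
      (MeasurableEquiv.prodAssoc.measurable hs))]
  refine lintegral_congr fun w => ?_
  rw [Kernel.prod_apply, Measure.prod_apply (measurable_prodMk_left hs)]
  rfl

variable {P : Measure Ω} [IsFiniteMeasure P]

/-- Conditional laws given W are almost everywhere unique, so any version η may replace the abstract
one. Regrouping then presents the reference measure as the law of (W, U) followed by η, which is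
explicit in the Gaussian case. -/
lemma map_compProd_condDistrib_prod [StandardBorelSpace α] [Nonempty α] [StandardBorelSpace β]
    [Nonempty β] {U : Ω → α} {V : Ω → β} {W : Ω → γ} (hU : Measurable U) (hV : Measurable V)
    {η : Kernel γ β} [IsMarkovKernel η]
    (hη : P.map (fun ω => (W ω, V ω)) = P.map W ⊗ₘ η) :
    P.map W ⊗ₘ (condDistrib U W P ×ₖ condDistrib V W P) =
      (P.map (fun ω => (W ω, U ω)) ⊗ₘ (η.prodMkRight α)).map MeasurableEquiv.prodAssoc := by
  have h := condDistrib_ae_eq_of_measure_eq_compProd W hV.aemeasurable hη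
  rw [← compProd_map_condDistrib hU.aemeasurable, ← compProd_prod_eq_map]
  refine Measure.compProd_congr ?_
  filter_upwards [h] with w hw
  rw [Kernel.prod_apply, Kernel.prod_apply, hw]

/-- If `V` has conditional law `η` given `W`, then `I(U ∧ V | W)` is the relative entropy of the
joint law with respect to the one where `V` is drawn from `η` without regard to `U`. -/
lemma condMutualInfo_eq_klDiv [StandardBorelSpace α] [Nonempty α] [StandardBorelSpace β]
    [Nonempty β] {U : Ω → α} {V : Ω → β} {W : Ω → γ} (hU : Measurable U) (hV : Measurable V)
    (hW : Measurable W) {η : Kernel γ β} [IsMarkovKernel η]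
    (hη : P.map (fun ω => (W ω, V ω)) = P.map W ⊗ₘ η) :
    condMutualInfo P U V W =
      klDiv (P.map (fun ω => ((W ω, U ω), V ω)))
        (P.map (fun ω => (W ω, U ω)) ⊗ₘ (η.prodMkRight α)) := by
  rw [condMutualInfo, map_compProd_condDistrib_prod hU hV hη,
    ← klDiv_map_equiv MeasurableEquiv.prodAssoc (P.map (fun ω => ((W ω, U ω), V ω))),
    Measure.map_map MeasurableEquiv.prodAssoc.measurable (by fun_prop)]
  rfl

/-- If the conditional law of `V` given `(W, U)` depends on `W` only, then `U - W - V`. -/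
lemma condIndepGiven_of_map_eq [StandardBorelSpace α] [Nonempty α] [StandardBorelSpace β]
    [Nonempty β] {U : Ω → α} {V : Ω → β} {W : Ω → γ} (hU : Measurable U) (hV : Measurable V)
    (hW : Measurable W) {η : Kernel γ β} [IsMarkovKernel η]
    (hη : P.map (fun ω => (W ω, V ω)) = P.map W ⊗ₘ η)
    (h : P.map (fun ω => ((W ω, U ω), V ω)) =
      P.map (fun ω => (W ω, U ω)) ⊗ₘ (η.prodMkRight α)) :
    CondIndepGiven P U V W := by
  rw [CondIndepGiven, map_compProd_condDistrib_prod hU hV hη, ← h,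
    Measure.map_map MeasurableEquiv.prodAssoc.measurable (by fun_prop)]
  rfl

end Kernels

/-! ### Gaussian kernels and their likelihood ratios -/

section GaussianKernel

variable {Ω α : Type*} [MeasurableSpace Ω] [MeasurableSpace α]

/-- The kernel `t ↦ N(m t, v)`. -/
noncomputable def gaussianKernel (m : α → ℝ) (hm : Measurable m) (v : ℝ≥0) : Kernel α ℝ where
  toFun t := gaussianReal (m t) v
  measurable' := measurable_gaussianReal.comp (hm.prodMk measurable_const)

lemma gaussianKernel_apply (m : α → ℝ) (hm : Measurable m) (v : ℝ≥0) (t : α) :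
    gaussianKernel m hm v t = gaussianReal (m t) v := rfl

instance (m : α → ℝ) (hm : Measurable m) (v : ℝ≥0) : IsMarkovKernel (gaussianKernel m hm v) :=
  ⟨fun t => by rw [gaussianKernel_apply]; infer_instance⟩

/-- If `X - m(T) ~ N(0, v)` is independent of `T`, then `X` has conditional law `N(m(T), v)`. -/
lemma map_prodMk_eq_compProd_gaussianKernel {P : Measure Ω} [IsFiniteMeasure P]
    {T : Ω → α} {X : Ω → ℝ} {m : α → ℝ} {v : ℝ≥0} (hT : Measurable T) (hX : Measurable X)
    (hm : Measurable m) (hind : IndepFun T (fun ω => X ω - m (T ω)) P)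
    (hlaw : HasLaw (fun ω => X ω - m (T ω)) (gaussianReal 0 v) P) :
    P.map (fun ω => (T ω, X ω)) = P.map T ⊗ₘ gaussianKernel m hm v := by
  have hN : Measurable (fun ω => X ω - m (T ω)) := hX.sub (hm.comp hT)
  have hφ : Measurable (fun p : α × ℝ => (p.1, p.2 + m p.1)) := by fun_prop
  have h1 : P.map (fun ω => (T ω, X ω)) =
      ((P.map T).prod (gaussianReal 0 v)).map (fun p : α × ℝ => (p.1, p.2 + m p.1)) := by
    rw [← hlaw.map_eq, ← (indepFun_iff_map_prod_eq_prod_map_map hT.aemeasurable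
      hN.aemeasurable).1 hind, Measure.map_map hφ (hT.prodMk hN)]
    congr 1
    ext ω <;> simp
  rw [h1]
  ext s hs
  rw [Measure.map_apply hφ hs, Measure.prod_apply (hφ hs), Measure.compProd_apply hs]
  refine lintegral_congr fun t => ?_
  rw [gaussianKernel_apply, ← zero_add (m t), ← gaussianReal_map_add_const,
    Measure.map_apply (by fun_prop) (measurable_prodMk_left hs)]
  rfl

/-- The log-likelihood ratio of `N(m₁, v₁)` with respect to `N(m₂, v₂)`. -/
noncomputable def gaussianLogRatio (m₁ m₂ : α → ℝ) (v₁ v₂ : ℝ≥0) (p : α × ℝ) : ℝ :=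
  Real.log (v₂ / v₁) / 2 - (p.2 - m₁ p.1) ^ 2 / (2 * v₁) + (p.2 - m₂ p.1) ^ 2 / (2 * v₂)

lemma measurable_gaussianLogRatio {m₁ m₂ : α → ℝ} (hm₁ : Measurable m₁) (hm₂ : Measurable m₂)
    (v₁ v₂ : ℝ≥0) : Measurable (gaussianLogRatio m₁ m₂ v₁ v₂) := by
  unfold gaussianLogRatio; fun_prop

lemma exp_gaussianLogRatio_mul {β : Type*} (m₁ m₂ : β → ℝ) {v₁ v₂ : ℝ≥0} (hv₁ : v₁ ≠ 0)
    (hv₂ : v₂ ≠ 0) (t : β) (x : ℝ) :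
    gaussianPDFReal (m₂ t) v₂ x * Real.exp (gaussianLogRatio m₁ m₂ v₁ v₂ (t, x)) =
      gaussianPDFReal (m₁ t) v₁ x := by
  have h1 : (0 : ℝ) < v₁ := by positivity
  have h2 : (0 : ℝ) < v₂ := by positivity
  have h3 : Real.exp (Real.log (v₂ / v₁) / 2) = √v₂ / √v₁ := by
    rw [← Real.log_sqrt (by positivity), Real.exp_log (by positivity), Real.sqrt_div h2.le]
  have h4 : gaussianLogRatio m₁ m₂ v₁ v₂ (t, x) = Real.log (v₂ / v₁) / 2 +
      (-(x - m₁ t) ^ 2 / (2 * v₁) - -(x - m₂ t) ^ 2 / (2 * v₂)) := by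
    simp only [gaussianLogRatio]; ring
  have h5 : √(v₁ : ℝ) ≠ 0 := by positivity
  have h6 : √(v₂ : ℝ) ≠ 0 := by positivity
  have h7 : √(2 * Real.pi) ≠ 0 := by positivity
  rw [h4, Real.exp_add, h3, Real.exp_sub, gaussianPDFReal, gaussianPDFReal,
    Real.sqrt_mul (by positivity) (v₁ : ℝ), Real.sqrt_mul (by positivity) (v₂ : ℝ)]
  generalize √(2 * Real.pi) = c at *
  field_simp

/-- Tilting by the log-likelihood ratio replaces `N(m₂, v₂)` by `N(m₁, v₁)`. -/
lemma compProd_gaussianKernel_withDensity (μ : Measure α) [SFinite μ] {m₁ m₂ : α → ℝ}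
    (hm₁ : Measurable m₁) (hm₂ : Measurable m₂) {v₁ v₂ : ℝ≥0} (hv₁ : v₁ ≠ 0) (hv₂ : v₂ ≠ 0) :
    (μ ⊗ₘ gaussianKernel m₂ hm₂ v₂).withDensity
        (fun p => ENNReal.ofReal (Real.exp (gaussianLogRatio m₁ m₂ v₁ v₂ p))) =
      μ ⊗ₘ gaussianKernel m₁ hm₁ v₁ := by
  have hf : Measurable fun p => ENNReal.ofReal (Real.exp (gaussianLogRatio m₁ m₂ v₁ v₂ p)) :=
    (Real.measurable_exp.comp (measurable_gaussianLogRatio hm₁ hm₂ v₁ v₂)).ennreal_ofReal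
  ext s hs
  rw [withDensity_apply _ hs, ← lintegral_indicator hs,
    Measure.lintegral_compProd (hf.indicator hs), Measure.compProd_apply hs]
  refine lintegral_congr fun t => ?_
  have hst := measurable_prodMk_left (x := t) hs
  rw [gaussianKernel_apply, gaussianKernel_apply, gaussianReal_of_var_ne_zero _ hv₁,
    gaussianReal_of_var_ne_zero _ hv₂, withDensity_apply _ hst, ← lintegral_indicator hst,
    lintegral_withDensity_eq_lintegral_mul _ (measurable_gaussianPDF _ _)
      (g := fun x => s.indicator _ (t, x)) ((hf.indicator hs).comp measurable_prodMk_left)]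
  refine lintegral_congr fun x => ?_
  by_cases hx : (t, x) ∈ s
  · have hx' : x ∈ Prod.mk t ⁻¹' s := hx
    simp only [Pi.mul_apply, Set.indicator_of_mem hx,
      Set.indicator_of_mem hx', gaussianPDF]
    rw [← ENNReal.ofReal_mul (gaussianPDFReal_nonneg _ _ _), exp_gaussianLogRatio_mul _ _ hv₁ hv₂]
  · have hx' : x ∉ Prod.mk t ⁻¹' s := hx
    simp [Set.indicator_of_notMem hx, Set.indicator_of_notMem hx']

/-- The integral is the total mass of the reweighted measure, which is again a probability measure.
Hence the likelihood ratio needs no normalizing constant. -/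
lemma integrable_exp_gaussianLogRatio (μ : Measure α) [IsProbabilityMeasure μ] {m₁ m₂ : α → ℝ}
    (hm₁ : Measurable m₁) (hm₂ : Measurable m₂) {v₁ v₂ : ℝ≥0} (hv₁ : v₁ ≠ 0) (hv₂ : v₂ ≠ 0) :
    Integrable (fun p => Real.exp (gaussianLogRatio m₁ m₂ v₁ v₂ p))
        (μ ⊗ₘ gaussianKernel m₂ hm₂ v₂) ∧
      ∫ p, Real.exp (gaussianLogRatio m₁ m₂ v₁ v₂ p) ∂(μ ⊗ₘ gaussianKernel m₂ hm₂ v₂) = 1 := by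
  have hf : Measurable fun p => Real.exp (gaussianLogRatio m₁ m₂ v₁ v₂ p) :=
    Real.measurable_exp.comp (measurable_gaussianLogRatio hm₁ hm₂ v₁ v₂)
  have h1 : ∫⁻ p, ENNReal.ofReal (Real.exp (gaussianLogRatio m₁ m₂ v₁ v₂ p))
      ∂(μ ⊗ₘ gaussianKernel m₂ hm₂ v₂) = 1 := by
    rw [← setLIntegral_univ, ← withDensity_apply _ MeasurableSet.univ,
      compProd_gaussianKernel_withDensity μ hm₁ hm₂ hv₁ hv₂, measure_univ]
  have h0 : 0 ≤ᵐ[μ ⊗ₘ gaussianKernel m₂ hm₂ v₂]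
      fun p => Real.exp (gaussianLogRatio m₁ m₂ v₁ v₂ p) := ae_of_all _ fun p => (Real.exp_pos _).le
  constructor
  · rw [← lintegral_ofReal_ne_top_iff_integrable hf.aestronglyMeasurable h0]
    exact h1 ▸ ENNReal.one_ne_top
  · rw [integral_eq_lintegral_of_nonneg_ae h0 hf.aestronglyMeasurable, h1, ENNReal.toReal_one]

lemma tilted_compProd_gaussianKernel (μ : Measure α) [IsProbabilityMeasure μ] {m₁ m₂ : α → ℝ}
    (hm₁ : Measurable m₁) (hm₂ : Measurable m₂) {v₁ v₂ : ℝ≥0} (hv₁ : v₁ ≠ 0) (hv₂ : v₂ ≠ 0) :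
    (μ ⊗ₘ gaussianKernel m₂ hm₂ v₂).tilted (gaussianLogRatio m₁ m₂ v₁ v₂) =
      μ ⊗ₘ gaussianKernel m₁ hm₁ v₁ := by
  rw [Measure.tilted, (integrable_exp_gaussianLogRatio μ hm₁ hm₂ hv₁ hv₂).2]
  simpa using compProd_gaussianKernel_withDensity μ hm₁ hm₂ hv₁ hv₂

end GaussianKernel

/-! ### The variational formula for relative entropy -/

section Tilted

variable {α : Type*} [MeasurableSpace α]

/-- The variational lower bound for the relative entropy. -/
lemma ofReal_integral_le_klDiv (μ ν : Measure α) [IsProbabilityMeasure μ] [IsProbabilityMeasure ν]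
    {f : α → ℝ} (hfμ : Integrable f μ) (hfν : Integrable (fun x => Real.exp (f x)) ν)
    (h1 : ∫ x, Real.exp (f x) ∂ν = 1) :
    ENNReal.ofReal (∫ x, f x ∂μ) ≤ klDiv μ ν := by
  by_cases h : μ ≪ ν ∧ Integrable (llr μ ν) μ
  · obtain ⟨hac, hint⟩ := h
    have := isProbabilityMeasure_tilted hfν
    -- The gap in the bound is the relative entropy of μ with respect to the tilted measure: `h2`
    -- expresses it as the difference of the two sides, `h3` says that it is nonnegative.
    have h2 := integral_llr_tilted_right hac hfμ hfν hint
    have h3 := integral_llr_add_sub_measure_univ_nonneg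
      (hac.trans (absolutelyContinuous_tilted hfν)) (integrable_llr_tilted_right hac hfμ hint hfν)
    rw [h1, Real.log_one] at h2
    simp only [probReal_univ] at h3
    rw [klDiv_of_ac_of_integrable hac hint]
    refine ENNReal.ofReal_le_ofReal ?_
    simp only [probReal_univ]
    linarith
  · rw [klDiv_eq_top_iff.2 (by tauto)]
    exact le_top

/-- This is the equality case: the normalizer is 1, so f itself is the log-likelihood ratio of the
tilted measure. -/
lemma klDiv_tilted (ν : Measure α) [IsProbabilityMeasure ν]
    {f : α → ℝ} (hfμ : Integrable f (ν.tilted f)) (hfν : Integrable (fun x => Real.exp (f x)) ν)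
    (h1 : ∫ x, Real.exp (f x) ∂ν = 1) :
    klDiv (ν.tilted f) ν = ENNReal.ofReal (∫ x, f x ∂(ν.tilted f)) := by
  have := isProbabilityMeasure_tilted hfν
  have hac := tilted_absolutelyContinuous ν f
  have h2 : llr (ν.tilted f) ν =ᵐ[ν.tilted f] f := by
    filter_upwards [hac.ae_le (log_rnDeriv_tilted_left_self hfν)] with x hx
    rw [llr, hx, h1, Real.log_one, sub_zero]
  rw [klDiv_of_ac_of_integrable hac ((integrable_congr h2).2 hfμ), integral_congr_ae h2]
  simp

end Tilted

/-! ### The Gaussian rate bound and its equality case -/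

section Information

variable {Ω α γ : Type*} [MeasurableSpace Ω] [MeasurableSpace α] [MeasurableSpace γ]
  {P : Measure Ω}

lemma memLp_two_of_hasLaw {N : Ω → ℝ} {m : ℝ} {v : ℝ≥0} (h : HasLaw N (gaussianReal m v) P) :
    MemLp N 2 P := h.hasGaussianLaw.memLp_two

lemma integral_sq_of_hasLaw {N : Ω → ℝ} {v : ℝ≥0} (h : HasLaw N (gaussianReal 0 v) P) :
    ∫ ω, N ω ^ 2 ∂P = v := by
  have h1 : Var[fun x => x; gaussianReal 0 v] = v := variance_fun_id_gaussianReal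
  rw [variance_of_integral_eq_zero (by fun_prop) (by simp)] at h1
  rw [← h1, ← h.map_eq, integral_map h.aemeasurable (by fun_prop)]

lemma integral_gaussianLogRatio {T : Ω → α} {X : Ω → ℝ} (hT : Measurable T) (hX : Measurable X)
    [IsProbabilityMeasure P]
    {m₁ m₂ : α → ℝ} (hm₁ : Measurable m₁) (hm₂ : Measurable m₂) (v₁ v₂ : ℝ≥0)
    (h₁ : Integrable (fun ω => (X ω - m₁ (T ω)) ^ 2) P)
    (h₂ : Integrable (fun ω => (X ω - m₂ (T ω)) ^ 2) P) :
    Integrable (gaussianLogRatio m₁ m₂ v₁ v₂) (P.map (fun ω => (T ω, X ω))) ∧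
      ∫ p, gaussianLogRatio m₁ m₂ v₁ v₂ p ∂(P.map (fun ω => (T ω, X ω))) =
        Real.log (v₂ / v₁) / 2 - (∫ ω, (X ω - m₁ (T ω)) ^ 2 ∂P) / (2 * v₁) +
          (∫ ω, (X ω - m₂ (T ω)) ^ 2 ∂P) / (2 * v₂) := by
  have hf := (measurable_gaussianLogRatio hm₁ hm₂ v₁ v₂).aestronglyMeasurable
    (μ := P.map (fun ω => (T ω, X ω)))
  have hc : Integrable (fun _ : Ω => Real.log (v₂ / v₁) / 2) P := integrable_const _
  constructor
  · rw [integrable_map_measure hf (by fun_prop)]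
    exact (hc.sub (h₁.div_const _)).add (h₂.div_const _)
  · rw [integral_map (by fun_prop) hf]
    simp only [gaussianLogRatio]
    rw [integral_add (f := fun ω => _ - _) (hc.sub (h₁.div_const _)) (h₂.div_const _),
      integral_sub hc (h₁.div_const _)]
    simp [integral_div]

variable [StandardBorelSpace α] [Nonempty α] [IsProbabilityMeasure P]
  {U : Ω → α} {X : Ω → ℝ} {W : Ω → γ}

lemma condMutualInfo_eq_klDiv_gaussian (hU : Measurable U) (hX : Measurable X) (hW : Measurable W)
    {m : γ → ℝ} (hm : Measurable m) {v : ℝ≥0}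
    (hind : IndepFun W (fun ω => X ω - m (W ω)) P)
    (hlaw : HasLaw (fun ω => X ω - m (W ω)) (gaussianReal 0 v) P) :
    condMutualInfo P U X W =
      klDiv (P.map (fun ω => ((W ω, U ω), X ω)))
        (P.map (fun ω => (W ω, U ω)) ⊗ₘ
          gaussianKernel (fun p : γ × α => m p.1) (hm.comp measurable_fst) v) :=
  condMutualInfo_eq_klDiv hU hX hW (map_prodMk_eq_compProd_gaussianKernel hW hX hm hind hlaw)

/-- A rate-distortion lower bound: if `X` is Gaussian with variance `v` given `W` and can be
estimated from `(W, U)` with mean squared error at most `d`, then `I(U ∧ X | W) ≥ log(v / d) / 2`. -/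
lemma le_condMutualInfo (hU : Measurable U) (hX : Measurable X) (hW : Measurable W)
    {m : γ → ℝ} (hm : Measurable m) {v d : ℝ≥0} (hv : v ≠ 0) (hd : d ≠ 0)
    (hind : IndepFun W (fun ω => X ω - m (W ω)) P)
    (hlaw : HasLaw (fun ω => X ω - m (W ω)) (gaussianReal 0 v) P)
    {g : γ × α → ℝ} (hg : Measurable g) (hmse : mse P X (fun ω => g (W ω, U ω)) ≤ d) :
    ENNReal.ofReal (Real.log (v / d) / 2) ≤ condMutualInfo P U X W := by
  have hT : Measurable (fun ω => (W ω, U ω)) := hW.prodMk hU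
  have hmeas : Measurable fun ω => (X ω - g (W ω, U ω)) ^ 2 := (hX.sub (hg.comp hT)).pow_const 2
  have h0 : 0 ≤ᵐ[P] fun ω => (X ω - g (W ω, U ω)) ^ 2 := ae_of_all _ fun ω => sq_nonneg _
  have h₁ : Integrable (fun ω => (X ω - g (W ω, U ω)) ^ 2) P := by
    rw [← lintegral_ofReal_ne_top_iff_integrable hmeas.aestronglyMeasurable h0]
    exact (hmse.trans_lt ENNReal.coe_lt_top).ne
  have h₁' : ∫ ω, (X ω - g (W ω, U ω)) ^ 2 ∂P ≤ d := by
    rw [integral_eq_lintegral_of_nonneg_ae h0 hmeas.aestronglyMeasurable]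
    exact ENNReal.toReal_mono ENNReal.coe_ne_top hmse
  have h₂ := (memLp_two_of_hasLaw hlaw).integrable_sq
  have h₂' := integral_sq_of_hasLaw hlaw
  have hm' : Measurable (fun p : γ × α => m p.1) := hm.comp measurable_fst
  have hP := Measure.isProbabilityMeasure_map (μ := P) hT.aemeasurable
  have hP' := Measure.isProbabilityMeasure_map (μ := P) (hT.prodMk hX).aemeasurable
  -- The test function compares N(g(W, U), d), the ideal law of X at distortion d, with the true
  -- conditional law N(m(W), v) given W alone.
  obtain ⟨hi, he⟩ := integral_gaussianLogRatio (P := P) hT hX hg hm' d v h₁ h₂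
  obtain ⟨hei, he1⟩ := integrable_exp_gaussianLogRatio (P.map (fun ω => (W ω, U ω))) hg hm' hd hv
  rw [condMutualInfo_eq_klDiv_gaussian hU hX hW hm hind hlaw]
  refine le_trans (ENNReal.ofReal_le_ofReal ?_) (ofReal_integral_le_klDiv _ _ hi hei he1)
  have hd' : (0 : ℝ) < d := by positivity
  have hv' : (v : ℝ) ≠ 0 := by positivity
  rw [he, h₂']
  -- The two quadratic terms are at most 1/2 and exactly 1/2, with opposite signs; only the
  -- logarithm is left.
  have h3 : (∫ ω, (X ω - g (W ω, U ω)) ^ 2 ∂P) / (2 * d) ≤ 1 / 2 := by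
    rw [div_le_div_iff₀ (by positivity) (by positivity)]; linarith
  have h4 : (v : ℝ) / (2 * v) = 1 / 2 := by field_simp
  linarith

/-- The lower bound `log(v / d) / 2` is attained if the estimation error is Gaussian and
independent of the observation. -/
lemma condMutualInfo_eq_log (hU : Measurable U) (hX : Measurable X) (hW : Measurable W)
    {m : γ → ℝ} (hm : Measurable m) {v d : ℝ≥0} (hv : v ≠ 0) (hd : d ≠ 0)
    (hind : IndepFun W (fun ω => X ω - m (W ω)) P)
    (hlaw : HasLaw (fun ω => X ω - m (W ω)) (gaussianReal 0 v) P)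
    {g : γ × α → ℝ} (hg : Measurable g)
    (hind' : IndepFun (fun ω => (W ω, U ω)) (fun ω => X ω - g (W ω, U ω)) P)
    (hlaw' : HasLaw (fun ω => X ω - g (W ω, U ω)) (gaussianReal 0 d) P) :
    condMutualInfo P U X W = ENNReal.ofReal (Real.log (v / d) / 2) := by
  have hT : Measurable (fun ω => (W ω, U ω)) := hW.prodMk hU
  have hm' : Measurable (fun p : γ × α => m p.1) := hm.comp measurable_fst
  have hP := Measure.isProbabilityMeasure_map (μ := P) hT.aemeasurable
  obtain ⟨hi, he⟩ := integral_gaussianLogRatio (P := P) hT hX hg hm' d v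
    (memLp_two_of_hasLaw hlaw').integrable_sq (memLp_two_of_hasLaw hlaw).integrable_sq
  obtain ⟨hei, he1⟩ := integrable_exp_gaussianLogRatio (P.map (fun ω => (W ω, U ω))) hg hm' hd hv
  -- By the hypotheses on the error, X has conditional law N(g(W, U), d) given (W, U), so the joint
  -- law is the tilt of the reference measure.
  have htilt := tilted_compProd_gaussianKernel (P.map (fun ω => (W ω, U ω))) hg hm' hd hv
  rw [← map_prodMk_eq_compProd_gaussianKernel hT hX hg hind' hlaw'] at htilt
  rw [← htilt] at hi he
  rw [condMutualInfo_eq_klDiv_gaussian hU hX hW hm hind hlaw, ← htilt, klDiv_tilted _ hi hei he1,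
    he, integral_sq_of_hasLaw hlaw, integral_sq_of_hasLaw hlaw']
  congr 1
  have hd' : (d : ℝ) ≠ 0 := by positivity
  have hv' : (v : ℝ) ≠ 0 := by positivity
  field_simp
  ring

end Information

/-! ### Least-squares estimation with an independent error -/

section Estimation

variable {Ω α : Type*} [MeasurableSpace Ω] [MeasurableSpace α] {P : Measure Ω}

lemma mse_eq_ofReal_integral {X V : Ω → ℝ} (h : MemLp (fun ω => X ω - V ω) 2 P) :
    mse P X V = ENNReal.ofReal (∫ ω, (X ω - V ω) ^ 2 ∂P) := by
  rw [mse, ofReal_integral_eq_lintegral_ofReal h.integrable_sq (ae_of_all _ fun ω => sq_nonneg _)]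

lemma mse_ne_top_iff {X V : Ω → ℝ} (hm : AEStronglyMeasurable (fun ω => X ω - V ω) P) :
    mse P X V ≠ ∞ ↔ MemLp (fun ω => X ω - V ω) 2 P := by
  rw [memLp_two_iff_integrable_sq hm, mse,
    lintegral_ofReal_ne_top_iff_integrable (f := fun ω => (X ω - V ω) ^ 2) (hm.pow 2)
      (ae_of_all _ fun ω => sq_nonneg _)]

lemma ae_eq_of_mse_eq_zero {X V : Ω → ℝ} (hm : Measurable (fun ω => X ω - V ω))
    (h : mse P X V = 0) : X =ᵐ[P] V := by
  rw [mse, lintegral_eq_zero_iff (hm.pow_const 2).ennreal_ofReal] at h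
  filter_upwards [h] with ω hω
  have h1 : (X ω - V ω) ^ 2 ≤ 0 := by simpa using hω
  nlinarith [sq_nonneg (X ω - V ω), pow_eq_zero_iff (two_ne_zero) |>.1
    (le_antisymm h1 (sq_nonneg _))]

/-- The Pythagorean identity for an estimate whose error is centred and independent of the
observation. -/
lemma mse_eq_add_of_indepFun {X : Ω → ℝ} {O : Ω → α} {h g : α → ℝ}
    (hX : Measurable X) (hO : Measurable O) (hh : Measurable h) (hg : Measurable g)
    (hind : IndepFun O (fun ω => X ω - h (O ω)) P)
    (hL2 : MemLp (fun ω => X ω - h (O ω)) 2 P) (hmean : ∫ ω, (X ω - h (O ω)) ∂P = 0) :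
    mse P X (fun ω => g (O ω)) =
      mse P X (fun ω => h (O ω)) + mse P (fun ω => h (O ω)) (fun ω => g (O ω)) := by
  have hN : Measurable fun ω => X ω - h (O ω) := hX.sub (hh.comp hO)
  have hD : Measurable fun ω => h (O ω) - g (O ω) := (hh.comp hO).sub (hg.comp hO)
  by_cases hD2 : MemLp (fun ω => h (O ω) - g (O ω)) 2 P
  · have hadd : (fun ω => X ω - g (O ω)) = (fun ω => (X ω - h (O ω)) + (h (O ω) - g (O ω))) := by
      ext ω; ring
    have hXg : MemLp (fun ω => X ω - g (O ω)) 2 P := hadd ▸ hL2.add hD2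
    rw [mse_eq_ofReal_integral hXg, mse_eq_ofReal_integral hL2, mse_eq_ofReal_integral hD2,
      ← ENNReal.ofReal_add (integral_nonneg fun ω => sq_nonneg _)
        (integral_nonneg fun ω => sq_nonneg _)]
    congr 1
    have hcross : ∫ ω, (X ω - h (O ω)) * (h (O ω) - g (O ω)) ∂P = 0 := by
      have hi : IndepFun (fun ω => X ω - h (O ω)) (fun ω => h (O ω) - g (O ω)) P :=
        hind.symm.comp measurable_id (hh.sub hg)
      rw [hi.integral_fun_mul_eq_mul_integral hN.aestronglyMeasurable hD.aestronglyMeasurable,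
        hmean, zero_mul]
    have hprod : Integrable (fun ω => (X ω - h (O ω)) * (h (O ω) - g (O ω))) P :=
      hL2.integrable_mul hD2
    have hexp : ∀ ω, (X ω - g (O ω)) ^ 2 = ((X ω - h (O ω)) ^ 2 + (h (O ω) - g (O ω)) ^ 2) +
        2 * ((X ω - h (O ω)) * (h (O ω) - g (O ω))) := fun ω => by ring
    simp_rw [hexp]
    rw [integral_add (f := fun ω => _ + _) (hL2.integrable_sq.add hD2.integrable_sq)
      (hprod.const_mul 2), integral_add hL2.integrable_sq hD2.integrable_sq, integral_const_mul,
      hcross, mul_zero, add_zero]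
  -- If the two estimates differ by a function that is not square integrable, both sides are
  -- infinite.
  · have hXg : ¬ MemLp (fun ω => X ω - g (O ω)) 2 P := fun h2 => hD2 <| by
      have : (fun ω => h (O ω) - g (O ω)) = fun ω => (X ω - g (O ω)) - (X ω - h (O ω)) := by
        ext ω; ring
      exact this ▸ h2.sub hL2
    rw [← mse_ne_top_iff hD.aestronglyMeasurable, not_not] at hD2
    rw [← mse_ne_top_iff (V := fun ω => g (O ω)) (hX.sub (hg.comp hO)).aestronglyMeasurable,
      not_not] at hXg
    rw [hXg, hD2, add_top]

/-- An estimate whose error is centred and independent of the observation is optimal. -/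
lemma isOptimalEstimate_of_indepFun {X : Ω → ℝ} {O : Ω → α} {h : α → ℝ}
    (hX : Measurable X) (hO : Measurable O) (hh : Measurable h)
    (hind : IndepFun O (fun ω => X ω - h (O ω)) P)
    (hL2 : MemLp (fun ω => X ω - h (O ω)) 2 P) (hmean : ∫ ω, (X ω - h (O ω)) ∂P = 0) :
    IsOptimalEstimate P X O (fun ω => h (O ω)) :=
  ⟨⟨h, hh, rfl⟩, fun _ hg => by
    rw [mse_eq_add_of_indepFun hX hO hh hg hind hL2 hmean]; exact le_self_add⟩

/-- The optimal estimate is almost surely unique. -/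
lemma IsOptimalEstimate.ae_eq_of_indepFun {X V : Ω → ℝ} {O : Ω → α} {h : α → ℝ}
    (hV : IsOptimalEstimate P X O V) (hX : Measurable X) (hO : Measurable O) (hh : Measurable h)
    (hind : IndepFun O (fun ω => X ω - h (O ω)) P)
    (hL2 : MemLp (fun ω => X ω - h (O ω)) 2 P) (hmean : ∫ ω, (X ω - h (O ω)) ∂P = 0) :
    V =ᵐ[P] fun ω => h (O ω) := by
  obtain ⟨⟨g, hg, rfl⟩, hmin⟩ := hV
  have h1 := hmin h hh
  rw [mse_eq_add_of_indepFun hX hO hh hg hind hL2 hmean] at h1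
  have hfin : mse P X (fun ω => h (O ω)) ≠ ∞ :=
    (mse_ne_top_iff (hX.sub (hh.comp hO)).aestronglyMeasurable).2 hL2
  have h2 : mse P (fun ω => h (O ω)) (fun ω => g (O ω)) = 0 := by
    rw [← nonpos_iff_eq_zero]
    exact (ENNReal.add_le_add_iff_left hfin).1 (by simpa using h1)
  exact (ae_eq_of_mse_eq_zero ((hh.comp hO).sub (hg.comp hO)) h2).symm

end Estimation

/-! ### Linear combinations of two independent Gaussians -/

section Pair

variable {Ω : Type*} [MeasurableSpace Ω] {P : Measure Ω}
  {U V : Ω → ℝ} {c z : ℝ≥0}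

lemma hasLaw_linear_combination (hU : HasLaw U (gaussianReal 0 c) P)
    (hV : HasLaw V (gaussianReal 0 z) P) (hUV : IndepFun U V P) (p q : ℝ) {w : ℝ≥0}
    (hw : p ^ 2 * c + q ^ 2 * z = w) :
    HasLaw (fun ω => p * U ω + q * V ω) (gaussianReal 0 w) P := by
  have h1 := gaussianReal_const_mul hU p
  have h2 := gaussianReal_const_mul hV q
  refine ⟨by fun_prop, ?_⟩
  have h := gaussianReal_add_gaussianReal_of_indepFun
    (hUV.comp (measurable_const_mul p) (measurable_const_mul q)) h1.map_eq h2.map_eq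
  rw [show (fun ω => p * U ω + q * V ω) = (fun ω => p * U ω) + fun ω => q * V ω from rfl]
  refine h.trans ?_
  congr 1
  · simp
  · ext; simpa using hw

/-- The two combinations are jointly Gaussian and `h0` says that their covariance is zero, which for
a Gaussian pair means independence. -/
lemma indepFun_linear_combination (hU : HasLaw U (gaussianReal 0 c) P)
    (hV : HasLaw V (gaussianReal 0 z) P) (hUV : IndepFun U V P) (p q p' q' : ℝ)
    (h0 : p * p' * c + q * q' * z = 0) :
    IndepFun (fun ω => p * U ω + q * V ω) (fun ω => p' * U ω + q' * V ω) P := by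
  have hG := hUV.hasGaussianLaw hU.hasGaussianLaw hV.hasGaussianLaw
  have := hG.isProbabilityMeasure
  let L : ℝ × ℝ →L[ℝ] ℝ × ℝ :=
    ((p • ContinuousLinearMap.fst ℝ ℝ ℝ) + q • ContinuousLinearMap.snd ℝ ℝ ℝ).prod
      ((p' • ContinuousLinearMap.fst ℝ ℝ ℝ) + q' • ContinuousLinearMap.snd ℝ ℝ ℝ)
  refine HasGaussianLaw.indepFun_of_covariance_eq_zero (hG.map_fun L) ?_
  have hU2 := memLp_two_of_hasLaw hU
  have hV2 := memLp_two_of_hasLaw hV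
  have hUV0 : cov[U, V; P] = 0 := hUV.covariance_eq_zero hU2 hV2
  have hVU0 : cov[V, U; P] = 0 := hUV.symm.covariance_eq_zero hV2 hU2
  have hUU : cov[U, U; P] = c := by
    rw [covariance_self hU.aemeasurable, hU.variance_eq, variance_id_gaussianReal]
  have hVV : cov[V, V; P] = z := by
    rw [covariance_self hV.aemeasurable, hV.variance_eq, variance_id_gaussianReal]
  change cov[(fun ω => p * U ω) + (fun ω => q * V ω),
    (fun ω => p' * U ω) + (fun ω => q' * V ω); P] = 0
  rw [covariance_add_left (hU2.const_mul p) (hV2.const_mul q)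
      ((hU2.const_mul p').add (hV2.const_mul q')),
    covariance_add_right (hU2.const_mul p) (hU2.const_mul p') (hV2.const_mul q'),
    covariance_add_right (hV2.const_mul q) (hU2.const_mul p') (hV2.const_mul q')]
  simp only [covariance_const_mul_left, covariance_const_mul_right, hUV0, hVU0, hUU, hVV]
  linarith

/-- The error of the linear estimate of `U` from `U + V`. -/
lemma hasLaw_sub_mul_add (hU : HasLaw U (gaussianReal 0 c) P)
    (hV : HasLaw V (gaussianReal 0 z) P) (hUV : IndepFun U V P) {l : ℝ} {w : ℝ≥0}
    (hcz : (c + z : ℝ) ≠ 0) (hl : l = c / (c + z)) (hw : (w : ℝ) = c * z / (c + z)) :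
    HasLaw (fun ω => U ω - l * (U ω + V ω)) (gaussianReal 0 w) P := by
  have h := hasLaw_linear_combination hU hV hUV (1 - l) (-l) (w := w)
    (by rw [hw, hl]; field_simp; ring)
  convert h using 2 with ω
  ring

/-- The regression coefficient `l` is the value at which the covariance (1 - l)c - lz vanishes. -/
lemma indepFun_add_sub_mul_add (hU : HasLaw U (gaussianReal 0 c) P)
    (hV : HasLaw V (gaussianReal 0 z) P) (hUV : IndepFun U V P) {l : ℝ}
    (hcz : (c + z : ℝ) ≠ 0) (hl : l = c / (c + z)) :
    IndepFun (fun ω => U ω + V ω) (fun ω => U ω - l * (U ω + V ω)) P := by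
  have h := indepFun_linear_combination hU hV hUV 1 1 (1 - l) (-l)
    (by rw [hl]; field_simp; ring)
  convert h using 2 with ω ω
  · ring
  · ring

end Pair

/-! ### Three independent Gaussians: the basic rate computation -/

section Triple

variable {Ω α β γ : Type*} [MeasurableSpace Ω] [MeasurableSpace α] [MeasurableSpace β]
  [MeasurableSpace γ] {P : Measure Ω} [IsProbabilityMeasure P]

/-- The hypotheses make the law of the triple a product of three measures, and such products may be
regrouped. -/
lemma indepFun_prodMk_assoc {A : Ω → α} {B : Ω → β} {C : Ω → γ} (hA : Measurable A)
    (hB : Measurable B) (hC : Measurable C) (h : IndepFun A (fun ω => (B ω, C ω)) P)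
    (hBC : IndepFun B C P) : IndepFun (fun ω => (A ω, B ω)) C P := by
  have hAB : IndepFun A B P := h.comp measurable_id measurable_fst
  rw [indepFun_iff_map_prod_eq_prod_map_map (by fun_prop) (by fun_prop)] at h hBC hAB ⊢
  have := Measure.isProbabilityMeasure_map (μ := P) hA.aemeasurable
  have := Measure.isProbabilityMeasure_map (μ := P) hB.aemeasurable
  have := Measure.isProbabilityMeasure_map (μ := P) hC.aemeasurable
  rw [hAB]
  rw [hBC] at h
  apply (MeasurableEquiv.prodAssoc (α := α) (β := β) (γ := γ)).map_measurableEquiv_injective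
  rw [Measure.prodAssoc_prod, ← h, Measure.map_map MeasurableEquiv.prodAssoc.measurable
    (by fun_prop)]
  rfl

lemma indepFun_prodMk_assoc_symm {A : Ω → α} {B : Ω → β} {C : Ω → γ} (hA : Measurable A)
    (hB : Measurable B) (hC : Measurable C) (h : IndepFun (fun ω => (A ω, B ω)) C P)
    (hAB : IndepFun A B P) : IndepFun A (fun ω => (B ω, C ω)) P := by
  have h1 : IndepFun C (fun ω => (B ω, A ω)) P := h.symm.comp measurable_id measurable_swap
  exact (indepFun_prodMk_assoc hC hB hA h1 hAB.symm).symm.comp measurable_id measurable_swap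

variable {B C Z : Ω → ℝ} {b c z : ℝ≥0}

/-- Given `B`, the error of estimating `C` from `C + Z` is independent of all observations. -/
lemma indepFun_prodMk_add_sub_mul_add (hBm : Measurable B) (hCm : Measurable C)
    (hZm : Measurable Z) (hC : HasLaw C (gaussianReal 0 c) P) (hZ : HasLaw Z (gaussianReal 0 z) P)
    (hB : IndepFun B (fun ω => (C ω, Z ω)) P) (hCZ : IndepFun C Z P) {l : ℝ}
    (hcz : (c + z : ℝ) ≠ 0) (hl : l = c / (c + z)) :
    IndepFun (fun ω => (B ω, C ω + Z ω)) (fun ω => C ω - l * (C ω + Z ω)) P := by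
  refine indepFun_prodMk_assoc hBm (by fun_prop) (by fun_prop) ?_
    (indepFun_add_sub_mul_add hC hZ hCZ hcz hl)
  exact hB.comp measurable_id
    (ψ := fun p : ℝ × ℝ => (p.1 + p.2, p.1 - l * (p.1 + p.2))) (by fun_prop)

/-- The conditional mutual information for independent Gaussians `B`, `C`, `Z`. -/
lemma condMutualInfo_gaussian (hBm : Measurable B) (hCm : Measurable C)
    (hZm : Measurable Z) (hBl : HasLaw B (gaussianReal 0 b) P)
    (hC : HasLaw C (gaussianReal 0 c) P) (hZ : HasLaw Z (gaussianReal 0 z) P)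
    (hB : IndepFun B (fun ω => (C ω, Z ω)) P) (hCZ : IndepFun C Z P) (hc : c ≠ 0) (hz : z ≠ 0)
    {κ : ℝ} (hκ : κ ≠ 0) {X W : Ω → ℝ} (hX : ∀ ω, X ω = B ω + C ω)
    (hW : ∀ ω, W ω = κ * (X ω + Z ω)) :
    condMutualInfo P B X W = ENNReal.ofReal
      (Real.log (((b + c : ℝ) * z / (b + c + z)) / (c * z / (c + z))) / 2) := by
  have hc' : (0 : ℝ) < c := by positivity
  have hz' : (0 : ℝ) < z := by positivity
  obtain rfl : X = fun ω => B ω + C ω := funext hX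
  obtain rfl : W = fun ω => κ * (B ω + C ω + Z ω) := funext hW
  have hBC : IndepFun B C P := hB.comp measurable_id measurable_fst
  have hBC_Z : IndepFun (fun ω => B ω + C ω) Z P :=
    (indepFun_prodMk_assoc hBm hCm hZm hB hCZ).comp
      (φ := fun p : ℝ × ℝ => p.1 + p.2) (by fun_prop) measurable_id
  have hXl : HasLaw (fun ω => B ω + C ω) (gaussianReal 0 (b + c)) P := by
    simpa using hasLaw_linear_combination hBl hC hBC 1 1 (w := b + c) (by simp)
  -- Here `l₂` is the coefficient for estimating B + C from B + C + Z, and `l₁` the one for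
  -- estimating C from C + Z, the problem that remains once B is known. Dividing by κ undoes the
  -- scaling of the side information.
  set l₁ : ℝ := c / (c + z) with hl₁
  set l₂ : ℝ := (b + c : ℝ≥0) / ((b + c : ℝ≥0) + z) with hl₂
  have hbc : ((b + c : ℝ≥0) + z : ℝ) ≠ 0 := by push_cast; positivity
  have e₂ : ∀ ω, B ω + C ω - l₂ / κ * (κ * (B ω + C ω + Z ω)) =
      B ω + C ω - l₂ * (B ω + C ω + Z ω) := fun ω => by field_simp
  have e₁ : ∀ ω, B ω + C ω - (B ω + l₁ * (κ * (B ω + C ω + Z ω) / κ - B ω)) =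
      C ω - l₁ * (C ω + Z ω) := fun ω => by field_simp; ring
  have key := condMutualInfo_eq_log (P := P) (U := B) (X := fun ω => B ω + C ω)
    (W := fun ω => κ * (B ω + C ω + Z ω)) hBm (by fun_prop) (by fun_prop)
    (m := fun w => l₂ / κ * w) (by fun_prop) (v := (b + c) * z / (b + c + z))
    (d := c * z / (c + z)) (by positivity) (by positivity)
    (by
      simp only [e₂]
      exact (indepFun_add_sub_mul_add hXl hZ hBC_Z hbc hl₂).comp
        (measurable_const_mul κ) measurable_id)
    (by
      simp only [e₂]
      exact hasLaw_sub_mul_add hXl hZ hBC_Z hbc hl₂ (by push_cast; rfl))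
    (g := fun p => p.2 + l₁ * (p.1 / κ - p.2)) (by fun_prop)
    (by
      simp only [e₁]
      refine (indepFun_prodMk_add_sub_mul_add hBm hCm hZm hC hZ hB hCZ (by positivity) hl₁).comp
        (φ := fun p : ℝ × ℝ => (κ * (p.1 + p.2), p.1)) (by fun_prop) measurable_id |>.congr ?_ ?_
      · exact ae_of_all _ fun ω => by simp [add_assoc]
      · rfl)
    (by
      simp only [e₁]
      exact hasLaw_sub_mul_add hC hZ hCZ (by positivity) hl₁ (by push_cast; rfl))
  rw [key]
  push_cast
  rfl

end Triple

/-! ### Transfer to copies of the source -/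

section Source

variable {Ω Ω' : Type*} [MeasurableSpace Ω] [MeasurableSpace Ω'] {P : Measure Ω} {Q : Measure Ω'}

/-- Being a Gaussian source depends on the joint law only. -/
lemma IsGaussianSource.of_map_eq [IsProbabilityMeasure P] [IsProbabilityMeasure Q] {s n : ℝ}
    {X Y : Ω → ℝ} {X' Y' : Ω' → ℝ} (h : IsGaussianSource P s n X Y)
    (hX : Measurable X) (hY : Measurable Y) (hX' : Measurable X') (hY' : Measurable Y')
    (hmap : Q.map (fun ω => (X' ω, Y' ω)) = P.map (fun ω => (X ω, Y ω))) :
    IsGaussianSource Q s n X' Y' := by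
  have key : ∀ {β : Type} [MeasurableSpace β] (φ : ℝ × ℝ → β), Measurable φ →
      Q.map (fun ω => φ (X' ω, Y' ω)) = P.map (fun ω => φ (X ω, Y ω)) := fun φ hφ => by
    have h1 := congrArg (Measure.map φ) hmap
    rwa [Measure.map_map hφ (by fun_prop), Measure.map_map hφ (by fun_prop)] at h1
  have k1 := key Prod.snd measurable_snd
  have k2 := key (fun p => p.1 - p.2) (by fun_prop)
  have k3 := key (fun p => (p.2, p.1 - p.2)) (by fun_prop)
  refine ⟨⟨hY'.aemeasurable, k1.trans h.law_side.map_eq⟩,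
    ⟨(hX'.sub hY').aemeasurable, k2.trans h.law_noise.map_eq⟩, ?_⟩
  have hi := h.indep
  rw [indepFun_iff_map_prod_eq_prod_map_map (by fun_prop) (by fun_prop)] at hi ⊢
  exact k3.trans (hi.trans (by rw [← k1, ← k2]))

end Source

/-! ### Variances of the parts and of their tails -/

section Variances

variable {r : ℕ} {σx2 Δ : ℝ} {σ2 : ℕ → ℝ}

/-- The admissible parameters. -/
structure IsAdmissible (r : ℕ) (σx2 Δ : ℝ) (σ2 : ℕ → ℝ) : Prop where
  pos : 0 < Δ
  lt : ∀ j, 1 ≤ j → j ≤ r → Δ < σ2 j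
  mono : ∀ i j, 1 ≤ i → i ≤ j → j ≤ r → σ2 i ≤ σ2 j
  lt_source : ∀ j, 1 ≤ j → j ≤ r → σ2 j < σx2

namespace IsAdmissible

/-- The product α_jΔ_j = σ_x²Δ_j / (σ_x² + Δ_j) is a harmonic combination, so its inverse is 1/Δ_j +
1/σ_x², and 1/Δ_j = 1/Δ - 1/σ_j². -/
lemma alpha_mul_testVar (h : IsAdmissible r σx2 Δ σ2) {j : ℕ} (h1 : 1 ≤ j) (hj : j ≤ r) :
    alpha σx2 Δ σ2 j * testVar Δ σ2 j = (1 / Δ - 1 / σ2 j + 1 / σx2)⁻¹ ∧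
      0 < 1 / Δ - 1 / σ2 j + 1 / σx2 ∧
      alpha σx2 Δ σ2 j * σx2 = σx2 - alpha σx2 Δ σ2 j * testVar Δ σ2 j ∧
      0 < alpha σx2 Δ σ2 j * σx2 := by
  have hΔ := h.pos
  have hs := h.lt j h1 hj
  have hx := h.lt_source j h1 hj
  have hs0 : 0 < σ2 j := hΔ.trans hs
  have hx0 : 0 < σx2 := hs0.trans hx
  have hd : 0 < σ2 j - Δ := sub_pos.2 hs
  have ht : 0 < testVar Δ σ2 j := by unfold testVar; positivity
  have hi : 1 / testVar Δ σ2 j = 1 / Δ - 1 / σ2 j := by unfold testVar; field_simp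
  have h3 : 1 / Δ - 1 / σ2 j + 1 / σx2 = (σx2 + testVar Δ σ2 j) / (σx2 * testVar Δ σ2 j) := by
    rw [← hi]; field_simp
  refine ⟨?_, ?_, ?_, ?_⟩
  · rw [h3, alpha, inv_div]; ring
  · rw [h3]; positivity
  · rw [alpha]; field_simp; ring
  · unfold alpha; positivity

/-- As σ_j² grows with j, so does the precision 1/Δ - 1/σ_j² + 1/σ_x²; hence α_jΔ_j is nonincreasing
and its successive differences are legitimate variances, possibly zero. -/
lemma partVar_nonneg (h : IsAdmissible r σx2 Δ σ2) (hr : 1 ≤ r) (t : ℕ) :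
    0 ≤ partVar r σx2 Δ σ2 t := by
  unfold partVar
  split_ifs with h0 h1
  · exact (h.alpha_mul_testVar le_rfl hr).2.2.2.le
  · obtain ⟨e, p, -⟩ := h.alpha_mul_testVar (j := t) (by omega) (by omega)
    obtain ⟨e', p', -⟩ := h.alpha_mul_testVar (j := t + 1) (by omega) (by omega)
    have hm := h.mono t (t + 1) (by omega) (by omega) (by omega)
    have hpos : 0 < σ2 t := h.pos.trans (h.lt t (by omega) (by omega))
    rw [e, e', sub_nonneg]
    have := one_div_le_one_div_of_le hpos hm
    exact inv_anti₀ p (by linarith)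
  · obtain ⟨e, p, -⟩ := h.alpha_mul_testVar hr le_rfl
    rw [e]; positivity

end IsAdmissible

/-- The variance of `X'_j + ⋯ + X'_r`. -/
noncomputable def tailVar (r : ℕ) (σx2 Δ : ℝ) (σ2 : ℕ → ℝ) (j : ℕ) : ℝ :=
  ∑ t ∈ Finset.Ico j (r + 1), partVar r σx2 Δ σ2 t

lemma tailVar_eq_add {j : ℕ} (hj : j ≤ r) :
    tailVar r σx2 Δ σ2 j = partVar r σx2 Δ σ2 j + tailVar r σx2 Δ σ2 (j + 1) :=
  Finset.sum_eq_sum_Ico_succ_bot (by omega) _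

/-- The sum telescopes from the top: the last part contributes α_rΔ_r, and each earlier one the
increment from index j + 1 to j. -/
lemma tailVar_eq {j : ℕ} (h1 : 1 ≤ j) (hj : j ≤ r) :
    tailVar r σx2 Δ σ2 j = alpha σx2 Δ σ2 j * testVar Δ σ2 j := by
  induction hj using Nat.decreasingInduction with
  | self => simp [tailVar, partVar, Nat.one_le_iff_ne_zero.1 h1]
  | of_succ n hn ih =>
    rw [tailVar_eq_add hn.le, ih (by omega), partVar, if_neg (by omega), if_pos hn]
    ring

lemma IsAdmissible.tailVar_zero (h : IsAdmissible r σx2 Δ σ2) (hr : 1 ≤ r) :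
    tailVar r σx2 Δ σ2 0 = σx2 := by
  rw [tailVar_eq_add (Nat.zero_le r), tailVar_eq le_rfl hr, partVar, if_pos rfl,
    (h.alpha_mul_testVar le_rfl hr).2.2.1]
  ring

lemma IsAdmissible.sum_range_partVar (h : IsAdmissible r σx2 Δ σ2) {k : ℕ} (hk1 : 1 ≤ k)
    (hk : k ≤ r) : ∑ t ∈ Finset.range k, partVar r σx2 Δ σ2 t = alpha σx2 Δ σ2 k * σx2 := by
  have h0 := h.tailVar_zero (hk1.trans hk)
  have h2 : ∑ t ∈ Finset.range k, partVar r σx2 Δ σ2 t + tailVar r σx2 Δ σ2 k = σx2 := by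
    rw [tailVar, ← Finset.range_eq_Ico] at h0
    rw [tailVar, Finset.sum_range_add_sum_Ico _ (by omega), h0]
  rw [(h.alpha_mul_testVar hk1 hk).2.2.1, ← tailVar_eq hk1 hk]
  linarith

lemma IsAdmissible.tailVar_pos (h : IsAdmissible r σx2 Δ σ2) (hr : 1 ≤ r) {j : ℕ} (hj : j ≤ r) :
    0 < tailVar r σx2 Δ σ2 j := by
  obtain rfl | h1 := Nat.eq_zero_or_pos j
  · rw [h.tailVar_zero hr]
    exact h.pos.trans ((h.lt r hr le_rfl).trans (h.lt_source r hr le_rfl))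
  · obtain ⟨e, p, -⟩ := h.alpha_mul_testVar h1 hj
    rw [tailVar_eq h1 hj, e]; positivity

end Variances

/-! ### Laws and independence of partial sums -/

section Sums

variable {Ω ι : Type*} [MeasurableSpace Ω] {P : Measure Ω} [IsProbabilityMeasure P]

lemma hasLaw_sum_of_iIndepFun [Fintype ι] [DecidableEq ι] {f : ι → Ω → ℝ} {v : ι → ℝ≥0}
    (hf : ∀ i, Measurable (f i))
    (hl : ∀ i, HasLaw (f i) (gaussianReal 0 (v i)) P) (hi : iIndepFun f P) (S : Finset ι) :
    HasLaw (fun ω => ∑ i ∈ S, f i ω) (gaussianReal 0 (∑ i ∈ S, v i)) P := by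
  induction S using Finset.induction_on with
  | empty =>
    refine ⟨by fun_prop, ?_⟩
    simp
  | insert a S ha ih =>
    have hind : IndepFun (fun ω => ∑ i ∈ S, f i ω) (f a) P := by
      have := hi.indepFun_finsetSum_of_notMem hf ha
      convert this using 1
      ext ω; simp
    have h := hasLaw_linear_combination (hl a) ih hind.symm 1 1 (w := v a + ∑ i ∈ S, v i)
      (by push_cast; ring)
    simpa [Finset.sum_insert ha] using h

end Sums

namespace IsGaussianParts

variable {Ω : Type*} [MeasurableSpace Ω] {P : Measure Ω}
  {r : ℕ} {σx2 σz2 Δ : ℝ} {σ2 : ℕ → ℝ} {X' : ℕ → Ω → ℝ} {Z' : Ω → ℝ}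

/-- The indices in `S` as elements of `Fin (r + 1)`. -/
def finIndices (r : ℕ) (S : Finset ℕ) : Finset (Fin (r + 1)) :=
  Finset.univ.filter fun i => (i : ℕ) ∈ S

/-- Needed because the partial sums run over natural numbers, whereas independence of the parts is
indexed by `Fin (r + 1)`. -/
lemma sum_eq_sum_finIndices {M : Type*} [AddCommMonoid M] {S : Finset ℕ}
    (hS : S ⊆ Finset.range (r + 1)) (f : ℕ → M) :
    ∑ t ∈ S, f t = ∑ i ∈ finIndices r S, f i := by
  rw [finIndices, Finset.sum_filter, Fin.sum_univ_eq_sum_range (fun i => if i ∈ S then f i else 0),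
    Finset.sum_ite_mem, Finset.inter_eq_right.2 hS]

lemma measurable_sum (h : IsGaussianParts P r σx2 σz2 Δ σ2 X' Z') {S : Finset ℕ}
    (hS : S ⊆ Finset.range (r + 1)) : Measurable (fun ω => ∑ t ∈ S, X' t ω) :=
  Finset.measurable_sum _ fun t ht =>
    h.measurable_part t (Nat.lt_succ_iff.1 (Finset.mem_range.1 (hS ht)))

lemma hasLaw_sum [IsProbabilityMeasure P] (h : IsGaussianParts P r σx2 σz2 Δ σ2 X' Z')
    (hadm : IsAdmissible r σx2 Δ σ2) (hr : 1 ≤ r) {S : Finset ℕ} (hS : S ⊆ Finset.range (r + 1)) :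
    HasLaw (fun ω => ∑ t ∈ S, X' t ω)
      (gaussianReal 0 (∑ t ∈ S, partVar r σx2 Δ σ2 t).toNNReal) P := by
  have hl := hasLaw_sum_of_iIndepFun (fun i : Fin (r + 1) => h.measurable_part i (by omega))
    (fun i => h.law_part i (by omega)) h.indep_parts (finIndices r S)
  rw [Real.toNNReal_sum_of_nonneg fun t _ => hadm.partVar_nonneg hr t]
  rw [sum_eq_sum_finIndices hS fun t => (partVar r σx2 Δ σ2 t).toNNReal]
  simpa only [sum_eq_sum_finIndices hS] using hl

lemma indepFun_sum_sum (h : IsGaussianParts P r σx2 σz2 Δ σ2 X' Z') {S T : Finset ℕ}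
    (hS : S ⊆ Finset.range (r + 1)) (hT : T ⊆ Finset.range (r + 1)) (hST : Disjoint S T) :
    IndepFun (fun ω => ∑ t ∈ S, X' t ω) (fun ω => ∑ t ∈ T, X' t ω) P := by
  have hd : Disjoint (finIndices r S) (finIndices r T) :=
    Finset.disjoint_filter.2 fun i _ h1 h2 => Finset.disjoint_left.1 hST h1 h2
  have hi := (h.indep_parts.indepFun_finset _ _ hd fun i => h.measurable_part i (by omega)).comp
    (φ := fun x => ∑ i, x i) (ψ := fun x => ∑ i, x i) (by fun_prop) (by fun_prop)
  simp only [sum_eq_sum_finIndices hS, sum_eq_sum_finIndices hT]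
  convert hi using 2 with ω ω
  · exact (Finset.sum_coe_sort _ fun i : Fin (r + 1) => X' i ω).symm
  · exact (Finset.sum_coe_sort _ fun i : Fin (r + 1) => X' i ω).symm

/-- The index sets may overlap: for the Markov relation, one is the whole range and the other an
initial segment of it. -/
lemma indepFun_sum_noise (h : IsGaussianParts P r σx2 σz2 Δ σ2 X' Z') {S T : Finset ℕ}
    (hS : S ⊆ Finset.range (r + 1)) (hT : T ⊆ Finset.range (r + 1)) :
    IndepFun (fun ω => (∑ t ∈ S, X' t ω, ∑ t ∈ T, X' t ω)) Z' P := by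
  simp only [sum_eq_sum_finIndices hS, sum_eq_sum_finIndices hT]
  exact h.indep_noise.comp (φ := fun x : Fin (r + 1) → ℝ =>
    (∑ i ∈ finIndices r S, x i, ∑ i ∈ finIndices r T, x i)) (by fun_prop) measurable_id

lemma indepFun_sum_prodMk [IsProbabilityMeasure P]
    (h : IsGaussianParts P r σx2 σz2 Δ σ2 X' Z') {S T : Finset ℕ}
    (hS : S ⊆ Finset.range (r + 1)) (hT : T ⊆ Finset.range (r + 1)) (hST : Disjoint S T) :
    IndepFun (fun ω => ∑ t ∈ S, X' t ω) (fun ω => (∑ t ∈ T, X' t ω, Z' ω)) P :=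
  indepFun_prodMk_assoc_symm (h.measurable_sum hS) (h.measurable_sum hT) h.measurable_noise
    (h.indepFun_sum_noise hS hT) (h.indepFun_sum_sum hS hT hST)

end IsGaussianParts

/-! ### Error variances and the linear estimate -/

/-- The variance of a Gaussian with variance `v` given its sum with noise of variance `z`. -/
noncomputable def errVar (z v : ℝ) : ℝ := v * z / (v + z)

lemma errVar_pos {z v : ℝ} (hz : 0 < z) (hv : 0 < v) : 0 < errVar z v := by
  unfold errVar; positivity

lemma errVar_mono {z v w : ℝ} (hz : 0 < z) (hv : 0 < v) (h : v ≤ w) : errVar z v ≤ errVar z w := by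
  have hw := hv.trans_le h
  rw [errVar, errVar, div_le_div_iff₀ (by positivity) (by positivity)]
  -- After cross-multiplication the common term vwz cancels and vz² ≤ wz² remains.
  nlinarith [mul_le_mul_of_nonneg_right h (sq_nonneg z)]

lemma errVar_inv {z v : ℝ} (hz : 0 < z) (hv : 0 < v) : errVar z v = (1 / v + 1 / z)⁻¹ := by
  rw [errVar]; field_simp; ring

/-- A telescoping sum of log-ratios. -/
lemma sum_ofReal_log_div {D : ℕ → ℝ} {k : ℕ} (hpos : ∀ j ≤ k, 0 < D j)
    (hanti : ∀ j < k, D (j + 1) ≤ D j) :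
    ∑ j ∈ Finset.range k, ENNReal.ofReal (Real.log (D j / D (j + 1)) / 2) =
      ENNReal.ofReal (Real.log (D 0 / D k) / 2) := by
  rw [← ENNReal.ofReal_sum_of_nonneg]
  · congr 1
    have h1 : ∀ j ∈ Finset.range k, Real.log (D j / D (j + 1)) / 2 =
        Real.log (D j) / 2 - Real.log (D (j + 1)) / 2 := fun j hj => by
      have hj := Finset.mem_range.1 hj
      rw [Real.log_div (hpos j hj.le).ne' (hpos (j + 1) hj).ne']; ring
    rw [Finset.sum_congr rfl h1, Finset.sum_range_sub', Real.log_div (hpos 0 (Nat.zero_le k)).ne'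
      (hpos k le_rfl).ne']
    ring
  -- Monotonicity of D enters here: `ENNReal.ofReal` is additive only on nonnegative terms.
  · intro j hj
    have hj := Finset.mem_range.1 hj
    have := Real.log_nonneg ((one_le_div (hpos (j + 1) hj)).2 (hanti j hj))
    positivity

/-- The variance of the noise `Z'`. -/
noncomputable def noiseVar (σx2 σz2 : ℝ) : ℝ := σx2 * σz2 / (σx2 - σz2)

/-- The tail `X'_k + ⋯ + X'_r`. -/
def tail {Ω : Type*} (r : ℕ) (X' : ℕ → Ω → ℝ) (k : ℕ) (ω : Ω) : ℝ :=
  ∑ t ∈ Finset.Ico k (r + 1), X' t ω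

lemma srcX_eq_add {Ω : Type*} {r k : ℕ} (X' : ℕ → Ω → ℝ) (hk : k ≤ r + 1) (ω : Ω) :
    srcX r X' ω = auxA X' k ω + tail r X' k ω := by
  rw [srcX, auxA, auxA, tail, Finset.sum_range_add_sum_Ico _ hk]

lemma tail_eq_add {Ω : Type*} {r k : ℕ} (X' : ℕ → Ω → ℝ) (hk : k ≤ r) (ω : Ω) :
    tail r X' k ω = X' k ω + tail r X' (k + 1) ω :=
  Finset.sum_eq_sum_Ico_succ_bot (by omega) _

lemma Ico_subset_range_succ (r k : ℕ) : Finset.Ico k (r + 1) ⊆ Finset.range (r + 1) :=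
  fun _ ht => Finset.mem_range.2 (Finset.mem_Ico.1 ht).2

lemma disjoint_range_Ico (r k : ℕ) : Disjoint (Finset.range k) (Finset.Ico k (r + 1)) :=
  Finset.disjoint_left.2 fun _ h1 h2 =>
    absurd (Finset.mem_range.1 h1) (not_lt.2 (Finset.mem_Ico.1 h2).1)

lemma noiseVar_pos {σx2 σz2 : ℝ} (hz : 0 < σz2) (hzx : σz2 < σx2) : 0 < noiseVar σx2 σz2 := by
  have := sub_pos.2 hzx
  have := hz.trans hzx
  unfold noiseVar; positivity

/-- The noise precision is 1/σ_z² - 1/σ_x²; adding the source precision 1/σ_x² leaves 1/σ_z². -/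
lemma errVar_noiseVar {σx2 σz2 : ℝ} (hz : 0 < σz2) (hzx : σz2 < σx2) :
    errVar (noiseVar σx2 σz2) σx2 = σz2 := by
  have h1 := sub_pos.2 hzx
  have h2 := hz.trans hzx
  have h3 : σx2 + σx2 * σz2 / (σx2 - σz2) = σx2 ^ 2 / (σx2 - σz2) := by field_simp; ring
  rw [errVar, noiseVar, h3]; field_simp

namespace IsAdmissible

/-- If the noise variance is `σ_k²`, then `X` has variance `Δ` given `Ȳ` and `A_k`. -/
lemma errVar_tailVar {r : ℕ} {σx2 Δ : ℝ} {σ2 : ℕ → ℝ} (h : IsAdmissible r σx2 Δ σ2)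
    {k : ℕ} (hk1 : 1 ≤ k) (hkr : k ≤ r) :
    errVar (noiseVar σx2 (σ2 k)) (tailVar r σx2 Δ σ2 k) = Δ := by
  have hs : 0 < σ2 k := h.pos.trans (h.lt k hk1 hkr)
  have hsx := h.lt_source k hk1 hkr
  have hx : 0 < σx2 := hs.trans hsx
  have hd : σx2 - σ2 k ≠ 0 := (sub_pos.2 hsx).ne'
  obtain ⟨e, p, -⟩ := h.alpha_mul_testVar hk1 hkr
  rw [errVar_inv (noiseVar_pos hs hsx) (h.tailVar_pos (hk1.trans hkr) hkr), tailVar_eq hk1 hkr, e,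
    one_div, inv_inv]
  -- The terms 1/σ_k² and 1/σ_x² of the noise precision cancel those in the precision of the tail,
  -- leaving 1/Δ.
  have h2 : 1 / noiseVar σx2 (σ2 k) = 1 / σ2 k - 1 / σx2 := by
    rw [noiseVar]; field_simp
  rw [h2]
  simp

/-- This identifies the coefficient in the stated estimate with the regression coefficient of the
tail on the tail plus noise. That coefficient is the error variance divided by the noise variance,
and the error variance is Δ. -/
lemma tailVar_div {r : ℕ} {σx2 Δ : ℝ} {σ2 : ℕ → ℝ} (h : IsAdmissible r σx2 Δ σ2)
    {k : ℕ} (hk1 : 1 ≤ k) (hkr : k ≤ r) :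
    (σx2 - σ2 k) * Δ / (σx2 * σ2 k) = tailVar r σx2 Δ σ2 k /
      (tailVar r σx2 Δ σ2 k + noiseVar σx2 (σ2 k)) := by
  have hs : 0 < σ2 k := h.pos.trans (h.lt k hk1 hkr)
  have hsx := h.lt_source k hk1 hkr
  have hx : 0 < σx2 := hs.trans hsx
  have hd : σx2 - σ2 k ≠ 0 := (sub_pos.2 hsx).ne'
  have hn := noiseVar_pos hs hsx
  have ht := h.tailVar_pos (hk1.trans hkr) hkr
  have h1 : Δ / noiseVar σx2 (σ2 k) = tailVar r σx2 Δ σ2 k /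
      (tailVar r σx2 Δ σ2 k + noiseVar σx2 (σ2 k)) := by
    nth_rw 1 [← h.errVar_tailVar hk1 hkr]
    rw [errVar]; field_simp
  rw [← h1, noiseVar]; field_simp

end IsAdmissible

/-- Since A_k is observed, it cancels, and what remains is the error of estimating the tail from the
tail plus Z'. -/
lemma srcX_sub_estimateX {Ω : Type*} {r k : ℕ} {σx2 Δ : ℝ} {σ2 : ℕ → ℝ} (X' : ℕ → Ω → ℝ)
    (Z' : Ω → ℝ) (hadm : IsAdmissible r σx2 Δ σ2) (hk1 : 1 ≤ k) (hkr : k ≤ r) (ω : Ω) :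
    srcX r X' ω - estimateX σx2 (σ2 k) Δ (sideY r σx2 (σ2 k) X' Z') (auxA X' k) ω =
      tail r X' k ω - (σx2 - σ2 k) * Δ / (σx2 * σ2 k) * (tail r X' k ω + Z' ω) := by
  have hsx := hadm.lt_source k hk1 hkr
  have hx : σx2 ≠ 0 := ((hadm.pos.trans (hadm.lt k hk1 hkr)).trans hsx).ne'
  have hd : σx2 - σ2 k ≠ 0 := (sub_pos.2 hsx).ne'
  have h1 : σx2 / (σx2 - σ2 k) * sideY r σx2 (σ2 k) X' Z' ω =
      auxA X' k ω + tail r X' k ω + Z' ω := by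
    rw [sideY, sideYbar, srcX_eq_add X' (k := k) (by omega)]; field_simp
  rw [estimateX, h1, srcX_eq_add X' (k := k) (by omega)]
  ring

/-! ### The construction: source, rates and Markov relation -/

namespace IsGaussianParts

variable {Ω : Type*} [MeasurableSpace Ω] {P : Measure Ω}
  {r : ℕ} {σx2 σz2 Δ : ℝ} {σ2 : ℕ → ℝ} {X' : ℕ → Ω → ℝ} {Z' : Ω → ℝ}

lemma measurable_auxA (h : IsGaussianParts P r σx2 σz2 Δ σ2 X' Z') {k : ℕ} (hk : k ≤ r + 1) :
    Measurable (auxA X' k) := h.measurable_sum (Finset.range_mono hk)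

lemma measurable_tail (h : IsGaussianParts P r σx2 σz2 Δ σ2 X' Z') (k : ℕ) :
    Measurable (tail r X' k) := h.measurable_sum (Ico_subset_range_succ r k)

lemma measurable_srcX (h : IsGaussianParts P r σx2 σz2 Δ σ2 X' Z') : Measurable (srcX r X') :=
  h.measurable_auxA le_rfl

lemma measurable_sideY (h : IsGaussianParts P r σx2 σz2 Δ σ2 X' Z') :
    Measurable (sideY r σx2 σz2 X' Z') :=
  (h.measurable_srcX.add h.measurable_noise).const_mul _

lemma indepFun_tail_noise (h : IsGaussianParts P r σx2 σz2 Δ σ2 X' Z') (k : ℕ) :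
    IndepFun (tail r X' k) Z' P :=
  (h.indepFun_sum_noise (Ico_subset_range_succ r k) (Ico_subset_range_succ r k)).comp
    measurable_fst measurable_id

variable [IsProbabilityMeasure P]

lemma hasLaw_tail (h : IsGaussianParts P r σx2 σz2 Δ σ2 X' Z') (hadm : IsAdmissible r σx2 Δ σ2)
    (hr : 1 ≤ r) (k : ℕ) :
    HasLaw (tail r X' k) (gaussianReal 0 (tailVar r σx2 Δ σ2 k).toNNReal) P :=
  h.hasLaw_sum hadm hr (Ico_subset_range_succ r k)

lemma indepFun_auxA_tail (h : IsGaussianParts P r σx2 σz2 Δ σ2 X' Z') {k : ℕ} (hk : k ≤ r + 1) :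
    IndepFun (auxA X' k) (fun ω => (tail r X' k ω, Z' ω)) P :=
  h.indepFun_sum_prodMk (Finset.range_mono hk) (Ico_subset_range_succ r k)
    (disjoint_range_Ico r k)

lemma indepFun_part_tail (h : IsGaussianParts P r σx2 σz2 Δ σ2 X' Z') {j : ℕ} (hj : j ≤ r) :
    IndepFun (X' j) (fun ω => (tail r X' (j + 1) ω, Z' ω)) P := by
  have := h.indepFun_sum_prodMk (S := {j}) (T := Finset.Ico (j + 1) (r + 1))
    (by simpa using Nat.lt_succ_of_le hj) (Ico_subset_range_succ r (j + 1)) (by simp)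
  simp only [Finset.sum_singleton] at this
  exact this

/-- The factor (σ_x² - σ_z²) / σ_x² is the regression coefficient of X on Ȳ. So Y is the linear
estimate of X from Ȳ, and X - Y is its error, independent of Y and of variance σ_z². -/
lemma isGaussianSource (h : IsGaussianParts P r σx2 σz2 Δ σ2 X' Z')
    (hadm : IsAdmissible r σx2 Δ σ2) (hr : 1 ≤ r) (hz : 0 < σz2) (hzx : σz2 < σx2) :
    IsGaussianSource P σx2 σz2 (srcX r X') (sideY r σx2 σz2 X' Z') := by
  have hx : 0 < σx2 := hz.trans hzx
  have hd : 0 < σx2 - σz2 := sub_pos.2 hzx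
  have hn := noiseVar_pos hz hzx
  have hX : srcX r X' = tail r X' 0 := by
    ext ω; rw [srcX_eq_add X' (Nat.zero_le _)]; simp [auxA]
  have hXl := h.hasLaw_tail hadm hr 0
  have hXZ := h.indepFun_tail_noise 0
  rw [hadm.tailVar_zero hr, ← hX] at hXl
  rw [← hX] at hXZ
  have hl : (σx2 - σz2) / σx2 =
      (σx2.toNNReal : ℝ) / (σx2.toNNReal + (noiseVar σx2 σz2).toNNReal) := by
    rw [Real.coe_toNNReal _ hx.le, Real.coe_toNNReal _ hn.le, noiseVar]
    field_simp; ring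
  have hne : (σx2.toNNReal : ℝ) + (noiseVar σx2 σz2).toNNReal ≠ 0 := by
    rw [Real.coe_toNNReal _ hx.le, Real.coe_toNNReal _ hn.le]; positivity
  refine ⟨?_, ?_, ?_⟩
  · have := hasLaw_linear_combination hXl h.law_noise hXZ ((σx2 - σz2) / σx2) ((σx2 - σz2) / σx2)
      (w := (σx2 - σz2).toNNReal) (by
        rw [← noiseVar, Real.coe_toNNReal _ hx.le, Real.coe_toNNReal _ hd.le,
          Real.coe_toNNReal _ hn.le, noiseVar]
        field_simp; ring)
    convert this using 2 with ω
    simp only [sideY, sideYbar]; ring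
  · refine hasLaw_sub_mul_add hXl h.law_noise hXZ hne hl ?_
    rw [Real.coe_toNNReal _ hx.le, Real.coe_toNNReal _ hz.le]
    have := errVar_noiseVar hz hzx
    rw [errVar] at this
    conv_lhs => rw [← this]
    rw [← noiseVar, Real.coe_toNNReal _ hn.le]
  · exact (indepFun_add_sub_mul_add hXl h.law_noise hXZ hne hl).comp
      (measurable_const_mul ((σx2 - σz2) / σx2)) measurable_id

lemma hasLaw_auxA (h : IsGaussianParts P r σx2 σz2 Δ σ2 X' Z') (hadm : IsAdmissible r σx2 Δ σ2)
    {k : ℕ} (hk1 : 1 ≤ k) (hkr : k ≤ r) :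
    HasLaw (auxA X' k) (gaussianReal 0 (alpha σx2 Δ σ2 k * σx2).toNNReal) P := by
  rw [← hadm.sum_range_partVar hk1 hkr]
  exact h.hasLaw_sum hadm (hk1.trans hkr) (Finset.range_mono (by omega))

/-- The rate of `A_k`, for side information proportional to `Ȳ`. -/
lemma condMutualInfo_auxA (h : IsGaussianParts P r σx2 σz2 Δ σ2 X' Z')
    (hadm : IsAdmissible r σx2 Δ σ2) {k : ℕ} (hk1 : 1 ≤ k) (hkr : k ≤ r)
    (hz : 0 < σz2) (hzx : σz2 < σx2) {κ : ℝ} (hκ : κ ≠ 0) {W : Ω → ℝ}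
    (hW : ∀ ω, W ω = κ * sideYbar r X' Z' ω) :
    condMutualInfo P (auxA X' k) (srcX r X') W = ENNReal.ofReal
      (Real.log (errVar (noiseVar σx2 σz2) (tailVar r σx2 Δ σ2 0) /
        errVar (noiseVar σx2 σz2) (tailVar r σx2 Δ σ2 k)) / 2) := by
  have hr := hk1.trans hkr
  have hn := noiseVar_pos hz hzx
  have ht := hadm.tailVar_pos hr hkr
  have ha := (hadm.alpha_mul_testVar hk1 hkr).2.2
  rw [condMutualInfo_gaussian (h.measurable_auxA (by omega)) (h.measurable_tail k)
    h.measurable_noise (h.hasLaw_auxA hadm hk1 hkr) (h.hasLaw_tail hadm hr k) h.law_noise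
    (h.indepFun_auxA_tail (by omega)) (h.indepFun_tail_noise k) (Real.toNNReal_pos.2 ht).ne'
    (Real.toNNReal_pos.2 hn).ne' hκ (srcX_eq_add X' (by omega)) hW, ← noiseVar,
    Real.coe_toNNReal _ hn.le, Real.coe_toNNReal _ ht.le, Real.coe_toNNReal _ ha.2.le,
    ha.1, ← tailVar_eq hk1 hkr, sub_add_cancel, hadm.tailVar_zero hr]
  rfl

/-- The rate of one round. -/
lemma condMutualInfo_part (h : IsGaussianParts P r σx2 σz2 Δ σ2 X' Z')
    (hadm : IsAdmissible r σx2 Δ σ2) {j : ℕ} (hj : j < r) (hz : 0 < σz2) (hzx : σz2 < σx2) :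
    condMutualInfo P (X' j) (roundX r X' (j + 1)) (roundY r X' Z' (j + 1)) = ENNReal.ofReal
      (Real.log (errVar (noiseVar σx2 σz2) (tailVar r σx2 Δ σ2 j) /
        errVar (noiseVar σx2 σz2) (tailVar r σx2 Δ σ2 (j + 1))) / 2) := by
  have hr : 1 ≤ r := by omega
  have hn := noiseVar_pos hz hzx
  have ht := hadm.tailVar_pos hr (Nat.succ_le_of_lt hj)
  -- Round j + 1 subtracts A_j, so its source is the tail starting at X'_j.
  have hX : ∀ ω, roundX r X' (j + 1) ω = X' j ω + tail r X' (j + 1) ω := fun ω => by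
    rw [roundX, ← tail_eq_add X' hj.le, srcX_eq_add X' (k := j) (by omega), Nat.add_sub_cancel,
      add_sub_cancel_left]
  rw [condMutualInfo_gaussian (h.measurable_part j hj.le) (h.measurable_tail (j + 1))
    h.measurable_noise (h.law_part j hj.le) (h.hasLaw_tail hadm hr (j + 1)) h.law_noise
    (h.indepFun_part_tail hj.le) (h.indepFun_tail_noise (j + 1)) (Real.toNNReal_pos.2 ht).ne'
    (Real.toNNReal_pos.2 hn).ne' one_ne_zero hX
    (fun ω => by rw [roundY, roundX, sideYbar]; ring), ← noiseVar,
    Real.coe_toNNReal _ hn.le, Real.coe_toNNReal _ ht.le,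
    Real.coe_toNNReal _ (hadm.partVar_nonneg hr j), ← tailVar_eq_add hj.le]
  rfl

/-- The rate of `A_k` is the sum of the rates of the first `k` rounds. -/
lemma condMutualInfo_auxA_eq_sum (h : IsGaussianParts P r σx2 σz2 Δ σ2 X' Z')
    (hadm : IsAdmissible r σx2 Δ σ2) {k : ℕ} (hk1 : 1 ≤ k) (hkr : k ≤ r)
    (hz : 0 < σz2) (hzx : σz2 < σx2) :
    condMutualInfo P (auxA X' k) (srcX r X') (sideYbar r X' Z') =
      ∑ j ∈ Finset.range k,
        condMutualInfo P (X' j) (roundX r X' (j + 1)) (roundY r X' Z' (j + 1)) := by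
  have hr := hk1.trans hkr
  have hn := noiseVar_pos hz hzx
  rw [h.condMutualInfo_auxA hadm hk1 hkr hz hzx one_ne_zero (fun ω => (one_mul _).symm),
    Finset.sum_congr rfl fun j hj => h.condMutualInfo_part hadm
      ((Finset.mem_range.1 hj).trans_le hkr) hz hzx]
  -- `D j` is the conditional variance of X given Ȳ and A_j. It is nonincreasing because the tail
  -- variance loses a nonnegative part in each round.
  refine (sum_ofReal_log_div (D := fun j => errVar (noiseVar σx2 σz2) (tailVar r σx2 Δ σ2 j))
    (fun j hj => errVar_pos hn (hadm.tailVar_pos hr (hj.trans hkr))) fun j hj => ?_).symm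
  refine errVar_mono hn (hadm.tailVar_pos hr (by omega)) ?_
  rw [tailVar_eq_add (j := j) (by omega)]
  exact le_add_of_nonneg_left (hadm.partVar_nonneg hr j)

/-- `A_k - X - Y`. -/
lemma condIndepGiven_auxA (h : IsGaussianParts P r σx2 σz2 Δ σ2 X' Z') {k : ℕ} (hk : k ≤ r) :
    CondIndepGiven P (auxA X' k) (sideY r σx2 σz2 X' Z') (srcX r X') := by
  set κ : ℝ := (σx2 - σz2) / σx2 with hκ
  have hA := h.measurable_auxA (k := k) (by omega)
  have hX := h.measurable_srcX
  have hY := h.measurable_sideY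
  -- Y = κX + κZ' with Z' independent of (X, A_k), so the conditional law of Y is N(κX, v) whether
  -- or not A_k is given as well.
  have e : ∀ ω, sideY r σx2 σz2 X' Z' ω - κ * srcX r X' ω = κ * Z' ω := fun ω => by
    rw [sideY, sideYbar, ← hκ]; ring
  have hind : IndepFun (fun ω => (srcX r X' ω, auxA X' k ω)) (fun ω => κ * Z' ω) P :=
    (h.indepFun_sum_noise (S := Finset.range (r + 1)) (T := Finset.range k) subset_rfl
      (Finset.range_mono (by omega))).comp measurable_id (measurable_const_mul κ)
  have hlaw := gaussianReal_const_mul h.law_noise κ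
  rw [mul_zero] at hlaw
  set v : ℝ≥0 := NNReal.mk (κ ^ 2) (sq_nonneg κ) * (σx2 * σz2 / (σx2 - σz2)).toNNReal
  refine condIndepGiven_of_map_eq (η := gaussianKernel (κ * ·) (measurable_const_mul κ) v) hA hY hX
    (map_prodMk_eq_compProd_gaussianKernel hX hY (measurable_const_mul κ) ?_ ?_)
    (map_prodMk_eq_compProd_gaussianKernel (T := fun ω => (srcX r X' ω, auxA X' k ω))
      (m := fun p => κ * p.1) (hX.prodMk hA) hY (by fun_prop) ?_ ?_)
  · simp only [e]
    exact hind.comp measurable_fst measurable_id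
  · simpa only [e] using hlaw
  · simpa only [e] using hind
  · simpa only [e] using hlaw

/-! ### Optimality when the noise variance is σ_k² -/

section Estimate

variable {k : ℕ}

/-- The error of the estimate is Gaussian with variance `Δ` and independent of the observation. -/
lemma estimateX_error (h : IsGaussianParts P r σx2 (σ2 k) Δ σ2 X' Z')
    (hadm : IsAdmissible r σx2 Δ σ2) (hk1 : 1 ≤ k) (hkr : k ≤ r) :
    IndepFun (fun ω => (sideY r σx2 (σ2 k) X' Z' ω, auxA X' k ω))
        (fun ω => srcX r X' ω -
          estimateX σx2 (σ2 k) Δ (sideY r σx2 (σ2 k) X' Z') (auxA X' k) ω) P ∧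
      HasLaw (fun ω => srcX r X' ω -
          estimateX σx2 (σ2 k) Δ (sideY r σx2 (σ2 k) X' Z') (auxA X' k) ω)
        (gaussianReal 0 Δ.toNNReal) P := by
  have hr := hk1.trans hkr
  have hz : 0 < σ2 k := hadm.pos.trans (hadm.lt k hk1 hkr)
  have hn := noiseVar_pos hz (hadm.lt_source k hk1 hkr)
  have ht := hadm.tailVar_pos hr hkr
  have hcz : ((tailVar r σx2 Δ σ2 k).toNNReal : ℝ) + (noiseVar σx2 (σ2 k)).toNNReal ≠ 0 := by
    rw [Real.coe_toNNReal _ ht.le, Real.coe_toNNReal _ hn.le]; positivity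
  have hl : (σx2 - σ2 k) * Δ / (σx2 * σ2 k) = ((tailVar r σx2 Δ σ2 k).toNNReal : ℝ) /
      ((tailVar r σx2 Δ σ2 k).toNNReal + (noiseVar σx2 (σ2 k)).toNNReal) := by
    rw [Real.coe_toNNReal _ ht.le, Real.coe_toNNReal _ hn.le, hadm.tailVar_div hk1 hkr]
  simp only [srcX_sub_estimateX X' Z' hadm hk1 hkr]
  constructor
  · have hi := (indepFun_prodMk_add_sub_mul_add (h.measurable_auxA (by omega))
      (h.measurable_tail k) h.measurable_noise (h.hasLaw_tail hadm hr k) h.law_noise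
      (h.indepFun_auxA_tail (by omega)) (h.indepFun_tail_noise k) hcz hl).comp
      (φ := fun p : ℝ × ℝ => ((σx2 - σ2 k) / σx2 * (p.1 + p.2), p.1)) (by fun_prop) measurable_id
    convert hi using 2 with ω ω
    simp only [Function.comp_apply, sideY, sideYbar, srcX_eq_add X' (k := k) (by omega : k ≤ r + 1),
      add_assoc]
    rfl
  · refine hasLaw_sub_mul_add (h.hasLaw_tail hadm hr k) h.law_noise (h.indepFun_tail_noise k)
      hcz hl ?_
    rw [← noiseVar, Real.coe_toNNReal _ ht.le, Real.coe_toNNReal _ hn.le,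
      Real.coe_toNNReal _ hadm.pos.le]
    exact (hadm.errVar_tailVar hk1 hkr).symm

lemma isAuxiliary_auxA (h : IsGaussianParts P r σx2 (σ2 k) Δ σ2 X' Z')
    (hadm : IsAdmissible r σx2 Δ σ2) (hk1 : 1 ≤ k) (hkr : k ≤ r) :
    IsAuxiliary P (srcX r X') (sideY r σx2 (σ2 k) X' Z') Δ (auxA X' k) where
  measurable := h.measurable_auxA (by omega)
  markov := h.condIndepGiven_auxA hkr
  distortion := by
    refine ⟨fun p => p.1 + (σx2 - σ2 k) * Δ / (σx2 * σ2 k) * (σx2 / (σx2 - σ2 k) * p.2 - p.1),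
      by fun_prop, ?_⟩
    have he := (h.estimateX_error hadm hk1 hkr).2
    refine (mse_eq_ofReal_integral (memLp_two_of_hasLaw he)).trans_le ?_
    rw [integral_sq_of_hasLaw he, Real.coe_toNNReal _ hadm.pos.le]

/-- In any copy of the source, X is N(Y, σ_k²) given Y, so every admissible auxiliary has rate at
least log(σ_k² / Δ) / 2. This is the rate of A_k, whose error variances before and after are σ_k²
and Δ. -/
lemma isOptimalAuxiliary_auxA (h : IsGaussianParts P r σx2 (σ2 k) Δ σ2 X' Z')
    (hadm : IsAdmissible r σx2 Δ σ2) (hk1 : 1 ≤ k) (hkr : k ≤ r) :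
    IsOptimalAuxiliary P (srcX r X') (sideY r σx2 (σ2 k) X' Z') Δ (auxA X' k) := by
  refine ⟨h.isAuxiliary_auxA hadm hk1 hkr, ?_⟩
  intro Ω' α _ _ _ _ Q _ X Y V hX hY hmap hV
  have hr := hk1.trans hkr
  have hz : 0 < σ2 k := hadm.pos.trans (hadm.lt k hk1 hkr)
  have hzx := hadm.lt_source k hk1 hkr
  have hs := (h.isGaussianSource hadm hr hz hzx).of_map_eq h.measurable_srcX h.measurable_sideY
    hX hY hmap
  obtain ⟨g, hg, hmse⟩ := hV.distortion
  have hlow := le_condMutualInfo hV.measurable hX hY measurable_id (v := (σ2 k).toNNReal)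
    (d := Δ.toNNReal) (Real.toNNReal_pos.2 hz).ne' (Real.toNNReal_pos.2 hadm.pos).ne'
    hs.indep hs.law_noise (g := fun p => g (p.2, p.1)) (hg.comp measurable_swap) hmse
  have hκ : (σx2 - σ2 k) / σx2 ≠ 0 := (div_pos (sub_pos.2 hzx) (hz.trans hzx)).ne'
  rw [h.condMutualInfo_auxA hadm hk1 hkr hz hzx hκ (W := sideY r σx2 (σ2 k) X' Z')
      fun ω => rfl, hadm.tailVar_zero hr,
    errVar_noiseVar hz hzx, hadm.errVar_tailVar hk1 hkr]
  rwa [Real.coe_toNNReal _ hz.le, Real.coe_toNNReal _ hadm.pos.le] at hlow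

lemma isOptimalEstimate_estimateX (h : IsGaussianParts P r σx2 (σ2 k) Δ σ2 X' Z')
    (hadm : IsAdmissible r σx2 Δ σ2) (hk1 : 1 ≤ k) (hkr : k ≤ r) :
    IsOptimalEstimate P (srcX r X') (fun ω => (sideY r σx2 (σ2 k) X' Z' ω, auxA X' k ω))
        (estimateX σx2 (σ2 k) Δ (sideY r σx2 (σ2 k) X' Z') (auxA X' k)) ∧
      ∀ V : Ω → ℝ,
        IsOptimalEstimate P (srcX r X')
          (fun ω => (sideY r σx2 (σ2 k) X' Z' ω, auxA X' k ω)) V →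
        V =ᵐ[P] estimateX σx2 (σ2 k) Δ (sideY r σx2 (σ2 k) X' Z') (auxA X' k) := by
  obtain ⟨hind, hlaw⟩ := h.estimateX_error hadm hk1 hkr
  have hO : Measurable fun ω => (sideY r σx2 (σ2 k) X' Z' ω, auxA X' k ω) :=
    h.measurable_sideY.prodMk (h.measurable_auxA (by omega))
  have hh : Measurable fun p : ℝ × ℝ =>
      p.2 + (σx2 - σ2 k) * Δ / (σx2 * σ2 k) * (σx2 / (σx2 - σ2 k) * p.1 - p.2) := by fun_prop
  have hL2 := memLp_two_of_hasLaw hlaw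
  have hmean := hlaw.integral_eq.trans integral_id_gaussianReal
  exact ⟨isOptimalEstimate_of_indepFun h.measurable_srcX hO hh hind hL2 hmean,
    fun V hV => hV.ae_eq_of_indepFun h.measurable_srcX hO hh hind hL2 hmean⟩

end Estimate

end IsGaussianParts

end WynerZiv

theorem lemma1 {Ω : Type*} [MeasurableSpace Ω] (P : Measure Ω) [IsProbabilityMeasure P]
    (r : ℕ) (σx2 σz2 Δ : ℝ) (σ2 : ℕ → ℝ)
    (hΔ : 0 < Δ)
    (hσΔ : ∀ j, 1 ≤ j → j ≤ r → Δ < σ2 j)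
    (hσmono : ∀ i j, 1 ≤ i → i ≤ j → j ≤ r → σ2 i ≤ σ2 j)
    (hσx : ∀ j, 1 ≤ j → j ≤ r → σ2 j < σx2)
    (hz : 0 < σz2) (hzx : σz2 < σx2)
    (X' : ℕ → Ω → ℝ) (Z' : Ω → ℝ)
    (hparts : IsGaussianParts P r σx2 σz2 Δ σ2 X' Z')
    (k : ℕ) (hk1 : 1 ≤ k) (hkr : k ≤ r) :
    -- the construction produces the given source, and `A_k ~ N(0, α_k σ_x²)`
    IsGaussianSource P σx2 σz2 (srcX r X') (sideY r σx2 σz2 X' Z') ∧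
    HasLaw (auxA X' k) (gaussianReal 0 (alpha σx2 Δ σ2 k * σx2).toNNReal) P ∧
    -- the decomposition of the rate, whatever the true noise variance is
    condMutualInfo P (auxA X' k) (srcX r X') (sideYbar r X' Z') =
      ∑ j ∈ Finset.range k,
        condMutualInfo P (X' j) (roundX r X' (j + 1)) (roundY r X' Z' (j + 1)) ∧
    -- if the noise variance is the guess `σ_k²`, then `A_k` is an optimal auxiliary, and the
    -- stated estimate is the optimal one, uniquely up to null sets
    (σz2 = σ2 k →
      IsOptimalAuxiliary P (srcX r X') (sideY r σx2 σz2 X' Z') Δ (auxA X' k) ∧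
      IsOptimalEstimate P (srcX r X') (fun ω => (sideY r σx2 σz2 X' Z' ω, auxA X' k ω))
        (estimateX σx2 (σ2 k) Δ (sideY r σx2 σz2 X' Z') (auxA X' k)) ∧
      ∀ V : Ω → ℝ,
        IsOptimalEstimate P (srcX r X') (fun ω => (sideY r σx2 σz2 X' Z' ω, auxA X' k ω)) V →
        V =ᵐ[P] estimateX σx2 (σ2 k) Δ (sideY r σx2 σz2 X' Z') (auxA X' k)) := by
  have hadm : IsAdmissible r σx2 Δ σ2 := ⟨hΔ, hσΔ, hσmono, hσx⟩
  refine ⟨hparts.isGaussianSource hadm (hk1.trans hkr) hz hzx, hparts.hasLaw_auxA hadm hk1 hkr,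
    hparts.condMutualInfo_auxA_eq_sum hadm hk1 hkr hz hzx, ?_⟩
  rintro rfl
  exact ⟨hparts.isOptimalAuxiliary_auxA hadm hk1 hkr,
    hparts.isOptimalEstimate_estimateX hadm hk1 hkr⟩
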